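/- For $k\in\{1,2,\dots\}\cup\{\infty\}$ and a smooth surface $S$ (a nonempty Hausdorff smooth $2$-manifold without boundary), a $C^k$ curve on $S$ is a connected, properly embedded one-dimensional $C^k$ submanifold of $S$ (that is, embedded and closed as a subset); it is a simple closed $C^k$ curve if it is moreover compact. Let $\mathrm{Homeo}^k(S)$ be the group of homeomorphisms $f$ of $S$ such that both $f$ and $f^{-1}$ map simple closed $C^k$ curves to simple closed $C^k$ curves. Define $m:\mathbb{R}^2\to\mathbb{R}$ by $m(x,y)=\dfrac{x}{\sqrt{x^2+y^2}}+2$ for $(x,y)\neq(0,0)$ and $m(0,0)=2$, and define $M:\mathbb{R}^2\to\mathbb{R}^2$ by $M(x,y)=(x\,m(x,y),\,y\,m(x,y))$. Then: 1. $M$ is a homeomorphism of $\mathbb{R}^2$, and $M$ and $M^{-1}$ send $C^1$ curves to $C^1$ curves (all properly embedded ones, compact or not). In particular $M\in\mathrm{Homeo}^1(\mathbb{R}^2)$. 2. The parabola $y=x^2$ is a $C^\infty$ curve. The parametrization $t\mapsto M(t,t^2)$ of its image is $C^\infty$ with nonzero derivative at every $t\neq0$, and the curvature of the image jumps at the origin: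 it tends to $2$ as $t\to0^-$ and to $\tfrac23$ as $t\to0^+$. The image of the parabola is not a $C^k$ curve for any $2\le k\le\infty$. 3. $M\notin\mathrm{Homeo}^k(\mathbb{R}^2)$ for every $2\le k\le\infty$. 4. For every smooth surface $S$ and every $2\le k\le\infty$, $\mathrm{Homeo}^1(S)\not\subset\mathrm{Homeo}^k(S)$. The same holds if, in the definition of these groups, "simple closed $C^k$ curves" is replaced by "$C^k$ curves". -/

import Mathlib

open Set Filter Topology
open scoped Manifold ContDiff

noncomputable section

/-- The Euclidean plane `ℝ²`. -/
abbrev Plane : Type := EuclideanSpace ℝ (Fin 2)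

section Curves

variable {S : Type*} [TopologicalSpace S] [ChartedSpace Plane S]

/-- `C` is an embedded one-dimensional `C^k` submanifold of the surface `S`: around each of its
points there is a `C^k` chart of `S` that carries `C` to the horizontal axis. -/
def IsCkOneSubmanifold (k : ℕ∞) (C : Set S) : Prop :=
  ∀ p ∈ C, ∃ φ ∈ IsManifold.maximalAtlas (𝓡 2) (k : WithTop ℕ∞) S,
    p ∈ φ.source ∧ ∀ q ∈ φ.source, q ∈ C ↔ φ q 1 = 0

/-- `C` is a `C^k` curve on `S`: a connected properly embedded (that is, embedded and closed as a
subset) one-dimensional `C^k` submanifold. -/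
def IsCkCurve (k : ℕ∞) (C : Set S) : Prop :=
  IsClosed C ∧ IsConnected C ∧ IsCkOneSubmanifold k C

/-- `C` is a simple closed `C^k` curve on `S`: a compact `C^k` curve. -/
def IsSimpleClosedCkCurve (k : ℕ∞) (C : Set S) : Prop :=
  IsCompact C ∧ IsCkCurve k C

end Curves

section Groups

/-- The subgroup of the homeomorphisms `f` of `X` such that both `f` and `f⁻¹` map members of the
family `P` of subsets of `X` to members of `P`. -/
def homeoPreserving {X : Type*} [TopologicalSpace X] (P : Set X → Prop) : Subgroup (X ≃ₜ X) where
  carrier := {f | (∀ C, P C → P (f '' C)) ∧ ∀ C, P C → P (f.symm '' C)}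
  one_mem' := by
    refine ⟨fun C hC => ?_, fun C hC => ?_⟩
    · have h : ((1 : X ≃ₜ X) '' C) = C := image_id C
      rwa [h]
    · have h : ((1 : X ≃ₜ X).symm '' C) = C := image_id C
      rwa [h]
  mul_mem' := by
    rintro f g ⟨hf, hf'⟩ ⟨hg, hg'⟩
    refine ⟨fun C hC => ?_, fun C hC => ?_⟩
    · have h : ((f * g : X ≃ₜ X) '' C) = f '' (g '' C) := image_comp f g C
      rw [h]
      exact hf _ (hg _ hC)
    · have h : ((f * g : X ≃ₜ X).symm '' C) = g.symm '' (f.symm '' C) :=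
        image_comp g.symm f.symm C
      rw [h]
      exact hg' _ (hf' _ hC)
  inv_mem' := by
    rintro f ⟨hf, hf'⟩
    exact ⟨hf', hf⟩

variable (k : ℕ∞) (S : Type*) [TopologicalSpace S] [ChartedSpace Plane S]

/-- `Homeo^k(S)`: the homeomorphisms `f` of `S` such that both `f` and `f⁻¹` map simple closed
`C^k` curves to simple closed `C^k` curves. -/
def HomeoCk : Subgroup (S ≃ₜ S) := homeoPreserving (IsSimpleClosedCkCurve k)

/-- The variant of `Homeo^k(S)` in which the curves are all properly embedded ones, compact or
not. If `S` is compact, it is the same group. -/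
def ProperHomeoCk : Subgroup (S ≃ₜ S) := homeoPreserving (IsCkCurve k)

end Groups

/-- The factor `m(x, y)`, which is `x / √(x² + y²) + 2` off the origin and `2` at the origin. -/
def mFactor (p : Plane) : ℝ :=
  open Classical in if p = 0 then 2 else p 0 / √(p 0 ^ 2 + p 1 ^ 2) + 2

/-- The map `M(x, y) = (x m(x, y), y m(x, y))` of the plane. -/
def mMap (p : Plane) : Plane := !₂[p 0 * mFactor p, p 1 * mFactor p]

/-- The parabola `y = x²`. -/
def parabola : Set Plane := {p | p 1 = p 0 ^ 2}

/-- The parametrization `t ↦ M(t, t²)` of the image of the parabola `y = x²` under `M`. -/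
def imageParam (t : ℝ) : Plane := mMap !₂[t, t ^ 2]

/-- The signed curvature `(x' y'' - y' x'') / (x'² + y'²)^(3/2)` of a plane curve `γ = (x, y)`
at `t`. It is meaningful where `γ` is twice differentiable with `γ' ≠ 0`. -/
def signedCurvature (γ : ℝ → Plane) (t : ℝ) : ℝ :=
  (deriv γ t 0 * deriv (deriv γ) t 1 - deriv γ t 1 * deriv (deriv γ) t 0) / ‖deriv γ t‖ ^ 3

end

/-! In polar terms `M` scales each ray by `2 + cos θ`. It is homogeneous of degree one and smooth
off the origin, so only curves through the origin matter.

First order: a `C^1` curve is locally `g = 0` with `dg ≠ 0`. Its preimage under `p ↦ h(p) p` is `G =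
0` with `G(p) = g(h(p) p) / h(p)`. Dividing by `h` makes the direction dependence cancel in the
linear term, so `dG = dg` at `0`. Although `dh` blows up like `1/‖p‖`, it enters `dG` only
multiplied by `dg_w(w) - g(w) = o(‖w‖)`, `w = h(p) p`, so `dG` is continuous
(`contDiffAt_div_comp_smul`). Near `0` the inverse map has the same form with factor `1/h`.

Second order: `y = a x² + o(x²)` is sent to a curve with `y/x²` tending to `a/(c + χ₀)` on one side
and `a/(c - χ₀)` on the other, whereas a `C^2` curve admits one limit only
(`exists_quadratic_coeff`).

On a general surface, `cos θ` is damped by a small bump function `χ`; the map is then compactly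
supported and can be transported by a chart. A circle tangent to the axis at the origin is a compact
test curve, so it settles both versions of the groups. -/

/-- Near `p`, the set `C` is an embedded one-dimensional `C^k` submanifold of the surface `S`. -/
def IsCkOneSubmanifoldAt {S : Type*} [TopologicalSpace S] [ChartedSpace Plane S]
    (k : ℕ∞) (C : Set S) (p : S) : Prop :=
  ∃ φ ∈ IsManifold.maximalAtlas (𝓡 2) (k : WithTop ℕ∞) S,
    p ∈ φ.source ∧ ∀ q ∈ φ.source, q ∈ C ↔ φ q 1 = 0

/-! ### Local submanifolds: germs, charts and defining functions -/

namespace IsCkOneSubmanifoldAt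

variable {S : Type*} [TopologicalSpace S] [ChartedSpace Plane S] {k : ℕ∞} {C C' : Set S} {p : S}

theorem mono {j : ℕ∞} (h : IsCkOneSubmanifoldAt k C p) (hj : j ≤ k) :
    IsCkOneSubmanifoldAt j C p := by
  obtain ⟨φ, hφ, h⟩ := h
  exact ⟨φ, IsManifold.maximalAtlas_subset_of_le (by exact_mod_cast hj) hφ, h⟩

theorem mem_restr {φ : OpenPartialHomeomorph S Plane}
    (hφ : φ ∈ IsManifold.maximalAtlas (𝓡 2) (k : WithTop ℕ∞) S) {s : Set S} (hs : IsOpen s) :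
    φ.restr s ∈ IsManifold.maximalAtlas (𝓡 2) (k : WithTop ℕ∞) S :=
  restr_mem_maximalAtlas (contDiffGroupoid (k : WithTop ℕ∞) (𝓡 2)) hφ hs

theorem congr (h : IsCkOneSubmanifoldAt k C p) (hC : ∀ᶠ q in 𝓝 p, q ∈ C ↔ q ∈ C') :
    IsCkOneSubmanifoldAt k C' p := by
  obtain ⟨φ, hφ, hp, h⟩ := h
  obtain ⟨s, hs, hso, hps⟩ := eventually_nhds_iff.1 hC
  refine ⟨φ.restr s, mem_restr hφ hso, ?_, ?_⟩
  · simpa [hso.interior_eq] using ⟨hp, hps⟩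
  · intro q hq
    rw [OpenPartialHomeomorph.restr_source, hso.interior_eq] at hq
    rw [← hs q hq.2]
    exact h q hq.1

/-- Together with `of_preimage_chart`, this moves every local question on `S` to the plane. -/
theorem preimage_chart [IsManifold (𝓡 2) k S] (h : IsCkOneSubmanifoldAt k C p)
    {ψ : OpenPartialHomeomorph S Plane}
    (hψ : ψ ∈ IsManifold.maximalAtlas (𝓡 2) (k : WithTop ℕ∞) S) (hp : p ∈ ψ.source) :
    IsCkOneSubmanifoldAt k (ψ.symm ⁻¹' C) (ψ p) := by
  obtain ⟨φ, hφ, hpφ, h⟩ := h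
  refine ⟨ψ.symm.trans φ, StructureGroupoid.mem_maximalAtlas_of_mem_groupoid _
    (IsManifold.compatible_of_mem_maximalAtlas hψ hφ), ?_, ?_⟩
  · simp [hp, hpφ]
  · intro q hq
    simp only [OpenPartialHomeomorph.trans_source, mem_inter_iff, mem_preimage] at hq
    exact h _ hq.2

theorem trans_mem_maximalAtlas [IsManifold (𝓡 2) k S] {ψ : OpenPartialHomeomorph S Plane}
    {φ : OpenPartialHomeomorph Plane Plane}
    (hψ : ψ ∈ IsManifold.maximalAtlas (𝓡 2) (k : WithTop ℕ∞) S)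
    (hφ : φ ∈ IsManifold.maximalAtlas (𝓡 2) (k : WithTop ℕ∞) Plane) :
    ψ.trans φ ∈ IsManifold.maximalAtlas (𝓡 2) (k : WithTop ℕ∞) S := by
  rw [IsManifold.mem_maximalAtlas_iff_contMDiffOn] at *
  refine ⟨?_, ?_⟩
  · exact hφ.1.comp (hψ.1.mono (by simp)) (by simp)
  · exact hψ.2.comp (hφ.2.mono (by simp)) (by simp)

theorem of_preimage_chart [IsManifold (𝓡 2) k S]
    {ψ : OpenPartialHomeomorph S Plane}
    (hψ : ψ ∈ IsManifold.maximalAtlas (𝓡 2) (k : WithTop ℕ∞) S) (hp : p ∈ ψ.source)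
    (h : IsCkOneSubmanifoldAt k (ψ.symm ⁻¹' C) (ψ p)) :
    IsCkOneSubmanifoldAt k C p := by
  obtain ⟨φ, hφ, hpφ, h⟩ := h
  refine ⟨ψ.trans φ, trans_mem_maximalAtlas hψ hφ, by simp [hp, hpφ], ?_⟩
  intro q hq
  simp only [OpenPartialHomeomorph.trans_source, mem_inter_iff, mem_preimage] at hq
  have := h _ hq.2
  simpa [hq.1] using this

/-- Locally a `C^k` submanifold of the plane is the zero set of a `C^k` submersion. -/
theorem exists_contDiffAt (hk : k ≠ 0) {D : Set Plane} {q : Plane}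
    (h : IsCkOneSubmanifoldAt k D q) :
    ∃ g : Plane → ℝ, ContDiffAt ℝ k g q ∧ fderiv ℝ g q ≠ 0 ∧ ∀ᶠ p in 𝓝 q, p ∈ D ↔ g p = 0 := by
  obtain ⟨φ, hφ, hq, h⟩ := h
  obtain ⟨h1, h2⟩ := (IsManifold.mem_maximalAtlas_iff_contMDiffOn φ).1 hφ
  rw [contMDiffOn_iff_contDiffOn] at h1 h2
  have hc : ContDiffAt ℝ k φ q := h1.contDiffAt (φ.open_source.mem_nhds hq)
  have hc' : ContDiffAt ℝ k φ.symm (φ q) :=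
    h2.contDiffAt (φ.open_target.mem_nhds (φ.map_source hq))
  have hk' : (k : WithTop ℕ∞) ≠ 0 := by exact_mod_cast hk
  let L : Plane →L[ℝ] ℝ := EuclideanSpace.proj 1
  refine ⟨fun p => L (φ p), L.contDiff.contDiffAt.comp q hc, ?_, ?_⟩
  · have e1 : HasFDerivAt (fun p => L (φ p)) (L.comp (fderiv ℝ φ q)) q :=
      L.hasFDerivAt.comp q (hc.differentiableAt hk').hasFDerivAt
    have e2 : HasFDerivAt φ.symm (fderiv ℝ φ.symm (φ q)) (φ q) :=
      (hc'.differentiableAt hk').hasFDerivAt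
    -- Since `φ ∘ φ.symm` is the identity near `φ q`, the nonzero functional `L` factors through the
    -- differential at `q`, which therefore is nonzero.
    have e3 : HasFDerivAt (fun y => L (φ (φ.symm y)))
        ((L.comp (fderiv ℝ φ q)).comp (fderiv ℝ φ.symm (φ q))) (φ q) := by
      refine HasFDerivAt.comp (g := fun p => L (φ p)) (φ q) ?_ e2
      rwa [φ.left_inv hq]
    have e4 : HasFDerivAt (fun y => L (φ (φ.symm y))) L (φ q) := by
      refine L.hasFDerivAt.congr_of_eventuallyEq ?_
      filter_upwards [φ.open_target.mem_nhds (φ.map_source hq)] with y hy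
      rw [φ.right_inv hy]
    intro h0
    rw [e1.fderiv] at h0
    have := e3.unique e4
    rw [h0, ContinuousLinearMap.zero_comp] at this
    have := DFunLike.congr_fun this (EuclideanSpace.single 1 1)
    simp [L] at this
  · filter_upwards [φ.open_source.mem_nhds hq] with p hp
    exact h p hp

end IsCkOneSubmanifoldAt

/-! ### Linear algebra of the plane and straightening of submersions -/

theorem Plane.eq_single_add_single (v : Plane) :
    v = v 0 • EuclideanSpace.single 0 1 + v 1 • EuclideanSpace.single 1 1 := by
  ext i; fin_cases i <;> simp

theorem Plane.clm_apply (ℓ : Plane →L[ℝ] ℝ) (v : Plane) :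
    ℓ v = v 0 * ℓ (EuclideanSpace.single 0 1) + v 1 * ℓ (EuclideanSpace.single 1 1) := by
  conv_lhs => rw [Plane.eq_single_add_single v]
  simp only [map_add, map_smul, smul_eq_mul]

/-- An injective continuous linear endomorphism of the plane is invertible. -/
theorem Plane.exists_equiv_of_injective (A : Plane →L[ℝ] Plane) (hA : ∀ v, A v = 0 → v = 0) :
    ∃ e : Plane ≃L[ℝ] Plane, (e : Plane →L[ℝ] Plane) = A := by
  have hi : Function.Injective (A : Plane →ₗ[ℝ] Plane) :=
    (injective_iff_map_eq_zero _).2 hA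
  refine ⟨(LinearEquiv.ofInjectiveEndo (A : Plane →ₗ[ℝ] Plane) hi).toContinuousLinearEquiv, ?_⟩
  ext v : 1
  rfl

/-- The zero set of a `C^k` submersion to the line is a `C^k` submanifold. -/
theorem IsCkOneSubmanifoldAt.of_contDiffOn {k : ℕ∞} (hk : k ≠ 0) {D U : Set Plane} {q : Plane}
    {g : Plane → ℝ} (hU : IsOpen U) (hqU : q ∈ U) (hg : ContDiffOn ℝ k g U)
    (hg' : fderiv ℝ g q ≠ 0) (hq : ∀ p ∈ U, p ∈ D ↔ g p = 0) :
    IsCkOneSubmanifoldAt k D q := by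
  have hk' : (k : WithTop ℕ∞) ≠ 0 := by exact_mod_cast hk
  set a : ℝ := fderiv ℝ g q (EuclideanSpace.single 0 1) with ha
  set b : ℝ := fderiv ℝ g q (EuclideanSpace.single 1 1) with hb
  -- This is `dg_q` rotated by a quarter turn, so the pair `(ℓ, dg_q)` has determinant `a² + b² ≠ 0`
  -- and `(ℓ, g)` is a local chart.
  let ℓ : Plane →L[ℝ] ℝ := b • EuclideanSpace.proj 0 - a • EuclideanSpace.proj 1
  let J : (ℝ × ℝ) →L[ℝ] Plane :=
    (EuclideanSpace.equiv (Fin 2) ℝ).symm.toContinuousLinearMap.comp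
      (ContinuousLinearMap.pi ![ContinuousLinearMap.fst ℝ ℝ ℝ, ContinuousLinearMap.snd ℝ ℝ ℝ])
  have J0 : ∀ x, J x 0 = x.1 := fun x => rfl
  have J1 : ∀ x, J x 1 = x.2 := fun x => rfl
  let G : Plane → Plane := fun p => J (ℓ p, g p)
  let G' : Plane → Plane →L[ℝ] Plane := fun p => J.comp (ℓ.prod (fderiv ℝ g p))
  have hab : b * b + a * a ≠ 0 := by
    intro h0
    have hb0 : b = 0 := by nlinarith [mul_self_nonneg a, mul_self_nonneg b]
    have ha0 : a = 0 := by nlinarith [mul_self_nonneg a, mul_self_nonneg b]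
    apply hg'
    ext v
    rw [Plane.clm_apply, ← ha, ← hb, ha0, hb0]; simp
  let det : Plane → ℝ := fun p => b * fderiv ℝ g p (EuclideanSpace.single 1 1)
    + a * fderiv ℝ g p (EuclideanSpace.single 0 1)
  have hcf : ContinuousOn (fderiv ℝ g) U := hg.continuousOn_fderiv_of_isOpen hU
    (by exact_mod_cast (Order.one_le_iff_ne_zero.2 hk))
  have hdet : ContinuousOn det U :=
    (continuousOn_const.mul (hcf.clm_apply continuousOn_const)).add
      (continuousOn_const.mul (hcf.clm_apply continuousOn_const))
  -- A chart needs a `C^k` inverse on its whole target, not just near the image of `q`; hence the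
  -- restriction to the set where the differential stays invertible.
  let V : Set Plane := U ∩ det ⁻¹' {0}ᶜ
  have hV : IsOpen V := hdet.isOpen_inter_preimage hU isOpen_compl_singleton
  have hqV : q ∈ V := ⟨hqU, hab⟩
  have hGc : ∀ p ∈ U, ContDiffAt ℝ k G p := fun p hp =>
    J.contDiff.contDiffAt.comp p
      (ℓ.contDiff.contDiffAt.prodMk (hg.contDiffAt (hU.mem_nhds hp)))
  have hGd : ∀ p ∈ U, HasFDerivAt G (G' p) p := fun p hp =>
    J.hasFDerivAt.comp p (ℓ.hasFDerivAt.prodMk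
      ((hg.contDiffAt (hU.mem_nhds hp)).differentiableAt hk').hasFDerivAt)
  have hinv : ∀ p ∈ V, ∃ e : Plane ≃L[ℝ] Plane, (e : Plane →L[ℝ] Plane) = G' p := by
    intro p hp
    refine Plane.exists_equiv_of_injective _ fun v hv => ?_
    have e0 : b * v 0 - a * v 1 = 0 := by
      have : G' p v 0 = 0 := by rw [hv]; rfl
      simpa [G', J0, ℓ] using this
    have e1 : fderiv ℝ g p v = 0 := by
      have : G' p v 1 = 0 := by rw [hv]; rfl
      simpa [G', J1] using this
    rw [Plane.clm_apply] at e1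
    have hd : det p ≠ 0 := hp.2
    have h0 : v 0 * det p = 0 := by
      simp only [det]
      linear_combination a * e1 + fderiv ℝ g p (EuclideanSpace.single 1 1) * e0
    have h1 : v 1 * det p = 0 := by
      simp only [det]
      linear_combination b * e1 - fderiv ℝ g p (EuclideanSpace.single 0 1) * e0
    have h0' : v 0 = 0 := (mul_eq_zero.1 h0).resolve_right hd
    have h1' : v 1 = 0 := (mul_eq_zero.1 h1).resolve_right hd
    rw [Plane.eq_single_add_single v, h0', h1']; simp
  obtain ⟨e, he⟩ := hinv q hqV
  have hGq : HasFDerivAt G (e : Plane →L[ℝ] Plane) q := by rw [he]; exact hGd q hqU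
  let Φ := ((hGc q hqU).toOpenPartialHomeomorph G hGq hk').restr V
  have hΦ : (Φ : Plane → Plane) = G := rfl
  have hsrc : Φ.source ⊆ V := by
    intro x hx
    rw [OpenPartialHomeomorph.restr_source, hV.interior_eq] at hx
    exact hx.2
  refine ⟨Φ, ?_, ?_, ?_⟩
  · rw [IsManifold.mem_maximalAtlas_iff_contMDiffOn]
    simp only [contMDiffOn_iff_contDiffOn]
    refine ⟨fun x hx => (hGc x (hsrc hx).1).contDiffWithinAt, fun y hy => ?_⟩
    have hy' := Φ.map_target hy
    obtain ⟨e', he'⟩ := hinv _ (hsrc hy')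
    refine (Φ.contDiffAt_symm (f₀' := e') hy ?_ ?_).contDiffWithinAt
    · rw [he']; exact hGd _ (hsrc hy').1
    · exact hGc _ (hsrc hy').1
  · rw [OpenPartialHomeomorph.restr_source, hV.interior_eq]
    exact ⟨(hGc q hqU).mem_toOpenPartialHomeomorph_source hGq hk', hqV⟩
  · intro p hp
    rw [hq p (hsrc hp).1]
    rfl

/-! ### Preservation of first-order smoothness at the origin -/

/-- If `g` is `C^1` at the origin and `h` is a bounded positive factor, `C^1` off the origin with
derivative `O(1 / ‖p‖)`, then `p ↦ g (h p • p) / h p` is `C^1` at the origin. -/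
theorem contDiffAt_div_comp_smul {E : Type*} [NormedAddCommGroup E] [NormedSpace ℝ E]
    {g h : E → ℝ} {c₁ c₂ K : ℝ} (hg : ContDiffAt ℝ 1 g 0) (hg0 : g 0 = 0) (hc₁ : 0 < c₁)
    (hb : ∀ᶠ p in 𝓝 0, c₁ ≤ h p ∧ h p ≤ c₂)
    (hh : ∀ᶠ p in 𝓝[≠] 0, ContDiffAt ℝ 1 h p ∧ ‖fderiv ℝ h p‖ * ‖p‖ ≤ K) :
    HasFDerivAt (fun p => g (h p • p) / h p) (fderiv ℝ g 0) 0 ∧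
      ContDiffAt ℝ 1 (fun p => g (h p • p) / h p) 0 := by
  set ℓ := fderiv ℝ g 0 with hℓ
  set H : E → ℝ := fun p => g (h p • p) / h p with hH
  have hc₂ : 0 < c₂ := by
    obtain ⟨a, b⟩ := hb.self_of_nhds; linarith
  have hgd : HasFDerivAt g ℓ 0 := (hg.differentiableAt (by norm_num)).hasFDerivAt
  have hsmul : Tendsto (fun p => h p • p) (𝓝 0) (𝓝 0) := by
    rw [tendsto_zero_iff_norm_tendsto_zero]
    have : Tendsto (fun p : E => c₂ * ‖p‖) (𝓝 0) (𝓝 0) := by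
      simpa using (tendsto_norm_zero (E := E)).const_mul c₂
    refine squeeze_zero' (Eventually.of_forall fun p => norm_nonneg _) ?_ this
    filter_upwards [hb] with p hp
    rw [norm_smul, Real.norm_of_nonneg (by linarith)]
    gcongr; exact hp.2
  have hlit : ∀ ε > 0, ∀ᶠ w in 𝓝 (0 : E), |g w - ℓ w| ≤ ε * ‖w‖ := by
    intro ε hε
    have := (hasFDerivAt_iff_isLittleO_nhds_zero.1 hgd).bound hε
    simpa [hg0] using this
  have h0 : HasFDerivAt H ℓ 0 := by
    rw [hasFDerivAt_iff_isLittleO_nhds_zero]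
    refine Asymptotics.isLittleO_iff.2 fun ε hε => ?_
    filter_upwards [hsmul.eventually (hlit ε hε), hb] with p hp hbp
    have hpos : 0 < h p := by linarith
    -- The linear part is homogeneous, so the factor `h p` cancels and only the remainder of `g` at
    -- `h p • p` is left.
    have e : H (0 + p) - H 0 - ℓ p = (g (h p • p) - ℓ (h p • p)) / h p := by
      simp only [hH, zero_add, smul_zero, hg0, zero_div, sub_zero, map_smul, smul_eq_mul]
      field_simp
    rw [e, norm_div, Real.norm_eq_abs, Real.norm_of_nonneg hpos.le, div_le_iff₀ hpos]
    rw [norm_smul, Real.norm_of_nonneg hpos.le] at hp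
    linarith
  refine ⟨h0, ?_⟩
  -- the derivative off the origin
  have hg1 : ∀ᶠ w in 𝓝 (0 : E), ContDiffAt ℝ 1 g w := hg.eventually (by norm_num)
  have hoff : ∀ᶠ p in 𝓝[≠] (0 : E), ContDiffAt ℝ 1 H p ∧ fderiv ℝ H p = fderiv ℝ g (h p • p)
      + ((fderiv ℝ g (h p • p) (h p • p) - g (h p • p)) / h p ^ 2) • fderiv ℝ h p := by
    filter_upwards [hh, (hsmul.eventually hg1).filter_mono nhdsWithin_le_nhds,
      hb.filter_mono nhdsWithin_le_nhds] with p hp hgp hbp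
    have hpos : h p ≠ 0 := by linarith
    refine ⟨(ContDiffAt.comp (f := fun y => h y • y) p hgp (hp.1.smul contDiffAt_id)).div
      hp.1 hpos, ?_⟩
    have d1 : HasFDerivAt h (fderiv ℝ h p) p :=
      (hp.1.differentiableAt (by norm_num)).hasFDerivAt
    have d2 : HasFDerivAt g (fderiv ℝ g (h p • p)) (h p • p) :=
      (hgp.differentiableAt (by norm_num)).hasFDerivAt
    have d3 := HasFDerivAt.comp (f := fun y => h y • y) p d2 (d1.smul (hasFDerivAt_id p))
    have d4 := d3.mul ((hasDerivAt_inv hpos).comp_hasFDerivAt p d1)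
    have : H = (g ∘ fun y => h y • y) * (Inv.inv ∘ h) := by
      ext y; simp [hH, div_eq_mul_inv]
    rw [this, d4.fderiv]
    ext v
    simp only [add_apply, smul_apply, Function.comp,
      ContinuousLinearMap.comp_apply, ContinuousLinearMap.smulRight_apply, smul_eq_mul,
      ContinuousLinearMap.id_apply, map_add, map_smul]
    field_simp
    ring
  have htend : Tendsto (fderiv ℝ H) (𝓝[≠] 0) (𝓝 ℓ) := by
    have hfc : ContinuousAt (fderiv ℝ g) 0 := hg.continuousAt_fderiv (by norm_num)
    have t1 : Tendsto (fun p => fderiv ℝ g (h p • p)) (𝓝[≠] 0) (𝓝 ℓ) :=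
      hfc.tendsto.comp (hsmul.mono_left nhdsWithin_le_nhds)
    -- Both `dg_w(w)` and `g(w)` are `ℓ w + o(‖w‖)`; their difference absorbs the `1/‖p‖` growth of
    -- `dh`.
    have t2 : Tendsto (fun p => ((fderiv ℝ g (h p • p) (h p • p) - g (h p • p)) / h p ^ 2) •
        fderiv ℝ h p) (𝓝[≠] 0) (𝓝 0) := by
      rw [Metric.tendsto_nhds]
      intro ε hε
      have hK : 0 < |K| + 1 := by positivity
      -- Chosen so that the final bound `2δ/c₁ * (|K| + 1)` equals `ε/2`.
      set δ := ε * c₁ / (4 * (|K| + 1)) with hδ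
      have hδ0 : 0 < δ := by positivity
      have near : ∀ᶠ w in 𝓝 (0 : E), ‖fderiv ℝ g w - ℓ‖ ≤ δ := by
        filter_upwards [hfc.tendsto.eventually (Metric.closedBall_mem_nhds _ hδ0)] with w hw
        simpa [dist_eq_norm] using hw
      filter_upwards [hh, (hsmul.eventually (near.and (hlit δ hδ0))).filter_mono
        nhdsWithin_le_nhds, hb.filter_mono nhdsWithin_le_nhds] with p hp hw hbp
      have hpos : 0 < h p := by linarith
      rw [dist_zero_right, norm_smul, norm_div, norm_pow, Real.norm_of_nonneg hpos.le]
      set w := h p • p with hwdef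
      have hwn : ‖w‖ = h p * ‖p‖ := by rw [hwdef, norm_smul, Real.norm_of_nonneg hpos.le]
      have b1 : ‖fderiv ℝ g w w - g w‖ ≤ 2 * δ * ‖w‖ := by
        have : fderiv ℝ g w w - g w = (fderiv ℝ g w - ℓ) w - (g w - ℓ w) := by
          simp
        rw [this]
        refine (norm_sub_le _ _).trans ?_
        have := (ContinuousLinearMap.le_opNorm (fderiv ℝ g w - ℓ) w).trans
          (mul_le_mul_of_nonneg_right hw.1 (norm_nonneg w))
        have h2 := hw.2
        rw [← Real.norm_eq_abs] at h2
        linarith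
      have hKp := hp.2
      calc ‖fderiv ℝ g w w - g w‖ / h p ^ 2 * ‖fderiv ℝ h p‖
          ≤ (2 * δ * (h p * ‖p‖)) / h p ^ 2 * ‖fderiv ℝ h p‖ := by
            rw [← hwn]; gcongr
        _ = 2 * δ / h p * (‖fderiv ℝ h p‖ * ‖p‖) := by field_simp
        _ ≤ 2 * δ / c₁ * (|K| + 1) := by
            have : ‖fderiv ℝ h p‖ * ‖p‖ ≤ |K| + 1 := by linarith [le_abs_self K]
            gcongr; exact hbp.1
        _ < ε := by
            rw [hδ]; field_simp; linarith
    have := t1.add t2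
    rw [add_zero] at this
    refine this.congr' ?_
    filter_upwards [hoff] with p hp using hp.2.symm
  have hcont0 : ContinuousAt (fderiv ℝ H) 0 := by
    rw [continuousAt_iff_punctured_nhds, h0.fderiv]
    exact htend
  rw [contDiffAt_one_iff]
  refine ⟨fderiv ℝ H, {p | p ≠ 0 → ContDiffAt ℝ 1 H p},
    eventually_nhdsWithin_iff.1 (hoff.mono fun p hp => hp.1), ?_, ?_⟩
  · intro p hp
    by_cases hp0 : p = 0
    · rw [hp0]; exact hcont0.continuousWithinAt
    · exact ((hp hp0).continuousAt_fderiv (by norm_num)).continuousWithinAt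
  · intro p hp
    by_cases hp0 : p = 0
    · rw [hp0, h0.fderiv]; exact h0
    · exact ((hp hp0).differentiableAt (by norm_num)).hasFDerivAt

/-- A homeomorphism of the plane that is a `C^1` diffeomorphism off the origin and multiplies
points near the origin by a bounded positive factor pulls `C^1` submanifolds back to
`C^1` submanifolds. -/
theorem IsCkOneSubmanifoldAt.preimage_homeomorph {T : Plane ≃ₜ Plane} {h : Plane → ℝ}
    {c₁ c₂ K : ℝ} (hT : ∀ p ≠ 0, ContDiffAt ℝ 1 T p) (hT' : ∀ p ≠ 0, ContDiffAt ℝ 1 T.symm p)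
    (hTh : ∀ᶠ p in 𝓝 0, T p = h p • p) (hc₁ : 0 < c₁)
    (hb : ∀ᶠ p in 𝓝 0, c₁ ≤ h p ∧ h p ≤ c₂)
    (hh : ∀ᶠ p in 𝓝[≠] 0, ContDiffAt ℝ 1 h p ∧ ‖fderiv ℝ h p‖ * ‖p‖ ≤ K)
    {D : Set Plane} {q : Plane} (hD : IsCkOneSubmanifoldAt 1 D (T q)) :
    IsCkOneSubmanifoldAt 1 (T ⁻¹' D) q := by
  have hT0 : T 0 = 0 := by simpa using hTh.self_of_nhds
  obtain ⟨g, hg, hg', hgD⟩ := hD.exists_contDiffAt one_ne_zero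
  suffices ∃ G : Plane → ℝ, ContDiffAt ℝ 1 G q ∧ fderiv ℝ G q ≠ 0 ∧
      ∀ᶠ p in 𝓝 q, p ∈ T ⁻¹' D ↔ G p = 0 by
    obtain ⟨G, hG, hG', hGD⟩ := this
    obtain ⟨U, hU, hUo, hqU⟩ := eventually_nhds_iff.1 ((hG.eventually (by norm_num)).and hGD)
    exact IsCkOneSubmanifoldAt.of_contDiffOn one_ne_zero hUo hqU
      (fun p hp => (hU p hp).1.contDiffWithinAt) hG' fun p hp => (hU p hp).2
  have hgT : ∀ᶠ p in 𝓝 q, p ∈ T ⁻¹' D ↔ g (T p) = 0 := T.continuous.continuousAt.eventually hgD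
  by_cases hq : q = 0
  · subst hq
    rw [hT0] at hg hg'
    by_cases hg0 : g 0 = 0
    · obtain ⟨d, c⟩ := contDiffAt_div_comp_smul (by exact_mod_cast hg) hg0 hc₁ hb hh
      refine ⟨_, c, by rwa [d.fderiv], ?_⟩
      filter_upwards [hgT, hb, hTh] with p hp hbp hTp
      rw [hp, hTp, div_eq_zero_iff, or_iff_left (by linarith)]
    -- The origin is off `D`, so the preimage is empty nearby. The local notion allows this, and any
    -- nonvanishing function with nonzero differential presents the empty set.
    · refine ⟨fun p => g p - g 0 + 1, (hg.sub contDiffAt_const).add contDiffAt_const,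
        by rwa [fderiv_add_const, fderiv_sub_const], ?_⟩
      have h1 : ∀ᶠ p in 𝓝 (0 : Plane), g (T p) ≠ 0 := by
        have : ContinuousAt (fun p => g (T p)) 0 := by
          refine ContinuousAt.comp (g := g) ?_ T.continuous.continuousAt
          rw [hT0]; exact hg.continuousAt
        exact this.eventually_ne (by rwa [hT0])
      have h2 : ∀ᶠ p in 𝓝 (0 : Plane), g p - g 0 + 1 ≠ 0 :=
        ((hg.continuousAt.sub continuousAt_const).add continuousAt_const).eventually_ne (by simp)
      filter_upwards [hgT, h1, h2] with p hp a b
      rw [hp]; exact iff_of_false a b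
  · have hTq : T q ≠ 0 := fun h => hq (T.injective (h.trans hT0.symm))
    refine ⟨fun p => g (T p), ContDiffAt.comp q (by exact_mod_cast hg) (hT q hq), ?_, hgT⟩
    have d1 : HasFDerivAt (fun p => g (T p)) ((fderiv ℝ g (T q)).comp (fderiv ℝ T q)) q :=
      (hg.differentiableAt (by norm_num)).hasFDerivAt.comp q
        ((hT q hq).differentiableAt (by norm_num)).hasFDerivAt
    have d2 : HasFDerivAt T.symm (fderiv ℝ T.symm (T q)) (T q) :=
      ((hT' _ hTq).differentiableAt (by norm_num)).hasFDerivAt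
    -- As `g = (g ∘ T) ∘ T.symm`, vanishing of `d(g ∘ T)` would force `dg = 0`.
    have d3 := HasFDerivAt.comp (g := fun p => g (T p)) (T q) (by simpa using d1) d2
    intro h0
    rw [← d1.fderiv, h0, ContinuousLinearMap.zero_comp] at d3
    have : ((fun p => g (T p)) ∘ T.symm) = g := by ext; simp
    rw [this] at d3
    exact hg' d3.fderiv

/-! ### Radial homeomorphisms -/

/-- A radial map `p ↦ h p • p`, strictly increasing on rays in the infinitesimal sense, is a
homeomorphism of the plane and a `C^1` diffeomorphism off the origin. -/
theorem exists_homeomorph_radial {h : Plane → ℝ} {c₁ c₂ : ℝ} (hc₁ : 0 < c₁)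
    (hb : ∀ p, c₁ ≤ h p ∧ h p ≤ c₂) (hh : ∀ p ≠ 0, ContDiffAt ℝ 1 h p)
    (hpos : ∀ p ≠ 0, 0 < h p + fderiv ℝ h p p) :
    ∃ T : Plane ≃ₜ Plane, (∀ p, T p = h p • p) ∧
      (∀ p ≠ 0, ContDiffAt ℝ 1 T p) ∧ ∀ p ≠ 0, ContDiffAt ℝ 1 T.symm p := by
  have hp0 : ∀ p, 0 < h p := fun p => hc₁.trans_le (hb p).1
  have hc₂ : 0 < c₂ := (hp0 0).trans_le (hb 0).2
  have hd : ∀ p ≠ 0, HasFDerivAt h (fderiv ℝ h p) p := fun p hp =>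
    ((hh p hp).differentiableAt (by norm_num)).hasFDerivAt
  set F : Plane → Plane := fun p => h p • p with hF
  have hFd : ∀ p ≠ 0, ContDiffAt ℝ 1 F p := fun p hp => (hh p hp).smul contDiffAt_id
  have hFn : ∀ p, ‖F p‖ = h p * ‖p‖ := fun p => by
    rw [hF, norm_smul, Real.norm_of_nonneg (hp0 p).le]
  -- along a ray
  have hray : ∀ q : Plane, q ≠ 0 → ∀ s ∈ Ioi (0 : ℝ), HasDerivAt (fun s : ℝ => s * h (s • q))
      (h (s • q) + fderiv ℝ h (s • q) (s • q)) s := by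
    intro q hq s hs
    have hsq : s • q ≠ 0 := smul_ne_zero (ne_of_gt hs) hq
    have d1 : HasDerivAt (fun s : ℝ => s • q) q s := by
      simpa using (hasDerivAt_id s).smul_const q
    have d2 := (hasDerivAt_id s).mul (HasFDerivAt.comp_hasDerivAt s (hd _ hsq) d1)
    have e : h (s • q) + fderiv ℝ h (s • q) (s • q)
        = 1 * (h ∘ fun s : ℝ => s • q) s + id s * fderiv ℝ h (s • q) q := by simp
    rw [e]
    exact d2
  have hmono : ∀ q : Plane, q ≠ 0 → StrictMonoOn (fun s : ℝ => s * h (s • q)) (Ioi 0) := by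
    intro q hq
    refine strictMonoOn_of_deriv_pos (convex_Ioi 0)
      (fun s hs => (hray q hq s hs).continuousAt.continuousWithinAt) ?_
    intro s hs
    rw [interior_Ioi] at hs
    rw [(hray q hq s hs).deriv]
    exact hpos _ (smul_ne_zero (ne_of_gt hs) hq)
  have hcont : Continuous F := by
    rw [continuous_iff_continuousAt]
    intro p
    by_cases hp : p = 0
    · subst hp
      have : Tendsto F (𝓝 0) (𝓝 0) := by
        rw [tendsto_zero_iff_norm_tendsto_zero]
        refine squeeze_zero (fun p => norm_nonneg _) (g := fun p => c₂ * ‖p‖) (fun p => ?_) ?_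
        · rw [hFn]; gcongr; exact (hb p).2
        · simpa using (tendsto_norm_zero (E := Plane)).const_mul c₂
      simpa [ContinuousAt, hF] using this
    · exact (hFd p hp).continuousAt
  have hinj : Function.Injective F := by
    intro p q hpq
    have hn := congrArg norm hpq
    rw [hFn, hFn] at hn
    by_cases hp : p = 0
    · subst hp
      have : ‖q‖ = 0 := by
        rw [norm_zero, mul_zero] at hn
        exact (mul_eq_zero.1 hn.symm).resolve_left (hp0 q).ne'
      exact (norm_eq_zero.1 this).symm
    · have hs : 0 < h p / h q := div_pos (hp0 p) (hp0 q)
      have hqs : q = (h p / h q) • p := by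
        have : h q • q = h p • p := hpq.symm
        rw [div_eq_inv_mul, mul_smul, ← this, smul_smul, inv_mul_cancel₀ (hp0 q).ne', one_smul]
      have h1 : (fun s : ℝ => s * h (s • p)) (h p / h q) = (fun s : ℝ => s * h (s • p)) 1 := by
        simp only [← hqs, one_smul, one_mul]
        exact div_mul_cancel₀ _ (hp0 q).ne'
      have := (hmono p hp).injOn hs (mem_Ioi.2 one_pos) h1
      rw [hqs, this, one_smul]
  have hsurj : Function.Surjective F := by
    intro q
    by_cases hq : q = 0
    · exact ⟨0, by simp [hF, hq]⟩
    · have hle : 1 / c₂ ≤ 1 / c₁ :=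
        one_div_le_one_div_of_le hc₁ ((hb 0).1.trans (hb 0).2)
      have hc : ContinuousOn (fun s : ℝ => s * h (s • q)) (Icc (1 / c₂) (1 / c₁)) := fun s hs =>
        (hray q hq s (lt_of_lt_of_le (by positivity) hs.1)).continuousAt.continuousWithinAt
      -- At `s = 1/c₂` the coefficient is at most `1`, at `s = 1/c₁` at least `1`.
      obtain ⟨s, -, hs⟩ := intermediate_value_Icc hle hc (show (1 : ℝ) ∈ Icc _ _ from by
        constructor
        · rw [div_mul_eq_mul_div, one_mul, div_le_one hc₂]; exact (hb _).2
        · rw [div_mul_eq_mul_div, one_mul, one_le_div hc₁]; exact (hb _).1)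
      refine ⟨s • q, ?_⟩
      simp only at hs
      rw [hF]
      simp only [smul_smul]
      rw [mul_comm, hs, one_smul]
  have hclosed : IsClosedMap F := by
    refine IsProperMap.isClosedMap (isProperMap_iff_tendsto_cocompact.2 ⟨hcont, ?_⟩)
    rw [← Metric.cobounded_eq_cocompact, ← tendsto_norm_atTop_iff_cobounded]
    refine tendsto_atTop_mono (fun p => ?_) (tendsto_norm_cobounded_atTop.const_mul_atTop hc₁)
    rw [hFn]; gcongr; exact (hb p).1
  let T : Plane ≃ₜ Plane :=
    (Equiv.ofBijective F ⟨hinj, hsurj⟩).toHomeomorphOfContinuousClosed hcont hclosed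
  have hTF : ∀ p, T p = F p := fun p => rfl
  have hT0 : T 0 = 0 := by rw [hTF]; simp [hF]
  refine ⟨T, fun p => rfl, hFd, fun y hy => ?_⟩
  have hx : T.symm y ≠ 0 := fun h0 => hy (by rw [← T.apply_symm_apply y, h0, hT0])
  set x := T.symm y
  have dF : HasFDerivAt F (h x • ContinuousLinearMap.id ℝ Plane + (fderiv ℝ h x).smulRight x) x :=
    (hd x hx).smul (hasFDerivAt_id x)
  obtain ⟨e, he⟩ := Plane.exists_equiv_of_injective
    (h x • ContinuousLinearMap.id ℝ Plane + (fderiv ℝ h x).smulRight x) (by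
      intro v hv
      simp only [add_apply, smul_apply, ContinuousLinearMap.id_apply,
        ContinuousLinearMap.smulRight_apply] at hv
      -- Applying `dh` to `h v + dh(v) x = 0` gives `dh(v) (h + dh(x)) = 0`, hence `dh(v) = 0` and
      -- then `v = 0`.
      have h1 := congrArg (fderiv ℝ h x) hv
      rw [map_add, map_smul, map_smul, map_zero, smul_eq_mul, smul_eq_mul] at h1
      have h2 : fderiv ℝ h x v * (h x + fderiv ℝ h x x) = 0 := by linarith
      have h3 := (mul_eq_zero.1 h2).resolve_right (hpos x hx).ne'
      rw [h3, zero_smul, add_zero] at hv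
      exact (smul_eq_zero.1 hv).resolve_left (hp0 x).ne')
  exact T.toOpenPartialHomeomorph.contDiffAt_symm (f₀' := e) (mem_univ y)
    (by rw [he]; exact dF) (hFd x hx)

/-! ### The factor with a cosine -/

/-- The factor `c + χ(p) cos θ`, where `θ` is the argument of `p`. -/
noncomputable def cosFactor (c : ℝ) (χ : Plane → ℝ) (p : Plane) : ℝ := c + χ p * (p 0 / ‖p‖)

theorem Plane.abs_apply_le (p : Plane) (i : Fin 2) : |p i| ≤ ‖p‖ := by
  simpa using PiLp.norm_apply_le p i

theorem Plane.abs_cos_le (p : Plane) : |p 0 / ‖p‖| ≤ 1 := by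
  rw [abs_div, abs_norm]
  exact div_le_one_of_le₀ (Plane.abs_apply_le p 0) (norm_nonneg p)

theorem Plane.contDiffAt_cos {n : WithTop ℕ∞} {p : Plane} (hp : p ≠ 0) :
    ContDiffAt ℝ n (fun p : Plane => p 0 / ‖p‖) p :=
  (EuclideanSpace.proj 0 : Plane →L[ℝ] ℝ).contDiff.contDiffAt.div
    (contDiffAt_norm ℝ hp) (norm_ne_zero_iff.2 hp)

/-- The cosine is homogeneous of degree `0`, so its derivative decays like `1/‖p‖`; each of the two
terms of the quotient rule contributes at most `1/‖p‖`. -/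
theorem Plane.norm_fderiv_cos_le {p : Plane} (hp : p ≠ 0) :
    ‖fderiv ℝ (fun p : Plane => p 0 / ‖p‖) p‖ * ‖p‖ ≤ 2 := by
  have hn : 0 < ‖p‖ := norm_pos_iff.2 hp
  have d1 : HasFDerivAt (fun p : Plane => p 0)
      (EuclideanSpace.proj 0 : Plane →L[ℝ] ℝ) p :=
    (EuclideanSpace.proj 0 : Plane →L[ℝ] ℝ).hasFDerivAt
  have d2 : HasFDerivAt (fun p : Plane => ‖p‖) (fderiv ℝ (fun p : Plane => ‖p‖) p) p :=
    ((contDiffAt_norm ℝ hp (n := 1)).differentiableAt (by norm_num)).hasFDerivAt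
  have hN : ‖fderiv ℝ (fun p : Plane => ‖p‖) p‖ ≤ 1 := by
    have := norm_fderiv_le_of_lipschitz ℝ (x₀ := p) (lipschitzWith_one_norm (E := Plane))
    simpa using this
  have d3 := d1.mul ((hasDerivAt_inv hn.ne').comp_hasFDerivAt p d2)
  have e : (fun p : Plane => p 0 / ‖p‖) = (fun p : Plane => p 0) * (Inv.inv ∘ fun p => ‖p‖) := by
    ext y; simp [div_eq_mul_inv]
  rw [e, d3.fderiv, ← le_div_iff₀ hn]
  refine ContinuousLinearMap.opNorm_le_bound _ (by positivity) fun v => ?_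
  have b1 := Plane.abs_apply_le p 0
  have b2 := Plane.abs_apply_le v 0
  have b3 : |fderiv ℝ (fun p : Plane => ‖p‖) p v| ≤ ‖v‖ := by
    have := (fderiv ℝ (fun p : Plane => ‖p‖) p).le_of_opNorm_le hN v
    simpa using this
  have : ∀ D : ℝ, |D| ≤ ‖v‖ → |p 0 * (-(‖p‖ ^ 2)⁻¹ * D) + ‖p‖⁻¹ * v 0| ≤ 2 / ‖p‖ * ‖v‖ := by
    intro D hD
    calc |p 0 * (-(‖p‖ ^ 2)⁻¹ * D) + ‖p‖⁻¹ * v 0|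
        ≤ |p 0 * (-(‖p‖ ^ 2)⁻¹ * D)| + |‖p‖⁻¹ * v 0| := abs_add_le _ _
      _ = |p 0| * ((‖p‖ ^ 2)⁻¹ * |D|) + ‖p‖⁻¹ * |v 0| := by
          simp only [abs_mul, abs_neg, abs_inv, abs_pow, abs_norm]
      _ ≤ ‖p‖ * ((‖p‖ ^ 2)⁻¹ * ‖v‖) + ‖p‖⁻¹ * ‖v‖ := by gcongr
      _ = 2 / ‖p‖ * ‖v‖ := by field_simp; ring
  simpa [Function.comp] using this _ b3

/-- Euler's relation: the cosine is constant on open rays. -/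
theorem Plane.fderiv_cos_apply_self {p : Plane} (hp : p ≠ 0) :
    fderiv ℝ (fun p : Plane => p 0 / ‖p‖) p p = 0 := by
  have d1 : HasDerivAt (fun s : ℝ => s • p) p 1 := by
    simpa using (hasDerivAt_id (1 : ℝ)).smul_const p
  have d0 : HasFDerivAt (fun p : Plane => p 0 / ‖p‖) (fderiv ℝ (fun p : Plane => p 0 / ‖p‖) p)
      ((1 : ℝ) • p) := by
    rw [one_smul]
    exact ((Plane.contDiffAt_cos hp (n := 1)).differentiableAt (by norm_num)).hasFDerivAt
  have d2 := HasFDerivAt.comp_hasDerivAt 1 d0 d1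
  have d3 : HasDerivAt ((fun p : Plane => p 0 / ‖p‖) ∘ fun s : ℝ => s • p) 0 1 := by
    refine (hasDerivAt_const (1 : ℝ) (p 0 / ‖p‖)).congr_of_eventuallyEq ?_
    filter_upwards [lt_mem_nhds one_pos] with s hs
    simp only [Function.comp, norm_smul, Real.norm_of_nonneg hs.le, PiLp.smul_apply, smul_eq_mul]
    exact mul_div_mul_left _ _ hs.ne'
  exact d2.unique d3

/-- `p ↦ (c + χ(p) cos θ) p`, with `χ` constant near the origin and small enough for the map to be
increasing on rays, is a homeomorphism that preserves `C^1` submanifolds, and so is its inverse. -/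
theorem exists_homeomorph_cosFactor {c b χ₀ : ℝ} {χ : Plane → ℝ} (hχ : ContDiff ℝ 1 χ)
    (hχ₀ : ∀ᶠ p in 𝓝 0, χ p = χ₀) (hbc : b < c) (hb : ∀ p, |χ p| ≤ b)
    (hd : ∀ p, |χ p + fderiv ℝ χ p p| < c) :
    ∃ T : Plane ≃ₜ Plane, (∀ p, T p = cosFactor c χ p • p) ∧
      (∀ D q, IsCkOneSubmanifoldAt 1 D (T q) → IsCkOneSubmanifoldAt 1 (T ⁻¹' D) q) ∧
      ∀ D q, IsCkOneSubmanifoldAt 1 D (T.symm q) → IsCkOneSubmanifoldAt 1 (T.symm ⁻¹' D) q := by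
  have hbd : ∀ p, c - b ≤ cosFactor c χ p ∧ cosFactor c χ p ≤ c + b := by
    intro p
    have h1 : |χ p * (p 0 / ‖p‖)| ≤ b := by
      rw [abs_mul]
      exact (mul_le_of_le_one_right (abs_nonneg _) (Plane.abs_cos_le p)).trans (hb p)
    have := abs_le.1 h1
    unfold cosFactor
    constructor <;> linarith
  have hsm : ∀ p ≠ 0, ContDiffAt ℝ 1 (cosFactor c χ) p := fun p hp =>
    contDiffAt_const.add (hχ.contDiffAt.mul (Plane.contDiffAt_cos hp))
  have hder : ∀ p ≠ 0, HasFDerivAt (cosFactor c χ)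
      (χ p • fderiv ℝ (fun p : Plane => p 0 / ‖p‖) p + (p 0 / ‖p‖) • fderiv ℝ χ p) p := by
    intro p hp
    exact ((hχ.differentiable (by norm_num) p).hasFDerivAt.mul
      ((Plane.contDiffAt_cos hp (n := 1)).differentiableAt (by norm_num)).hasFDerivAt).const_add c
  have hpos : ∀ p ≠ 0, 0 < cosFactor c χ p + fderiv ℝ (cosFactor c χ) p p := by
    intro p hp
    rw [(hder p hp).fderiv]
    -- By Euler's relation the radial derivative is `c + cos θ (χ + dχ(p))`, which `hd` keeps
    -- positive.
    simp only [add_apply, smul_apply, Plane.fderiv_cos_apply_self hp, smul_eq_mul]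
    have h1 : |(p 0 / ‖p‖) * (χ p + fderiv ℝ χ p p)| < c := by
      rw [abs_mul]
      exact (mul_le_of_le_one_left (abs_nonneg _) (Plane.abs_cos_le p)).trans_lt (hd p)
    have := (abs_lt.1 h1).1
    unfold cosFactor
    linarith
  obtain ⟨T, hT, hT1, hT2⟩ := exists_homeomorph_radial (sub_pos.2 hbc) hbd hsm hpos
  have hc0 : ∀ p, 0 < cosFactor c χ p := fun p => (sub_pos.2 hbc).trans_le (hbd p).1
  -- near the origin the factor depends on the direction only
  have hloc : ∀ᶠ p in 𝓝 (0 : Plane), ∀ᶠ q in 𝓝 p, χ q = χ₀ := hχ₀.eventually_nhds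
  have hK : ∀ᶠ p in 𝓝[≠] (0 : Plane), ‖fderiv ℝ (cosFactor c χ) p‖ * ‖p‖ ≤ |χ₀| * 2 := by
    filter_upwards [hloc.filter_mono nhdsWithin_le_nhds, self_mem_nhdsWithin] with p hp hp0
    have : fderiv ℝ χ p = 0 := by
      have : χ =ᶠ[𝓝 p] fun _ => χ₀ := hp
      rw [this.fderiv_eq]; simp
    rw [(hder p hp0).fderiv, this, smul_zero, add_zero, norm_smul, hp.self_of_nhds, mul_assoc,
      Real.norm_eq_abs]
    exact mul_le_mul_of_nonneg_left (Plane.norm_fderiv_cos_le hp0) (abs_nonneg _)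
  have hsmall : Tendsto T.symm (𝓝 0) (𝓝 0) := by
    have : T.symm 0 = 0 := by rw [T.symm_apply_eq, hT, smul_zero]
    simpa [this] using T.symm.continuous.tendsto 0
  -- `T` preserves rays and near the origin the factor depends only on the ray, so it has the same
  -- value at `q` and at `T.symm q`.
  have hsymm : ∀ᶠ q in 𝓝 (0 : Plane), T.symm q = (cosFactor c χ q)⁻¹ • q := by
    filter_upwards [hsmall.eventually hχ₀, hχ₀] with q h1 h2
    have hq : q = cosFactor c χ (T.symm q) • T.symm q := by rw [← hT, T.apply_symm_apply]
    set p := T.symm q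
    have hcp := hc0 p
    have : cosFactor c χ q = cosFactor c χ p := by
      have hcos : q 0 / ‖q‖ = p 0 / ‖p‖ := by
        rw [hq, norm_smul, Real.norm_of_nonneg hcp.le, PiLp.smul_apply, smul_eq_mul,
          mul_div_mul_left _ _ hcp.ne']
      rw [cosFactor, cosFactor, h1, h2, hcos]
    rw [this]
    rw [eq_inv_smul_iff₀ hcp.ne']
    exact hq.symm
  refine ⟨T, hT, fun D q hD => ?_, fun D q hD => ?_⟩
  · refine hD.preimage_homeomorph hT1 hT2 (Eventually.of_forall hT) (sub_pos.2 hbc)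
      (Eventually.of_forall hbd) (K := |χ₀| * 2) ?_
    filter_upwards [hK, self_mem_nhdsWithin] with p hp hp0 using ⟨hsm p hp0, hp⟩
  · have hcb : 0 < c + b := (hc0 0).trans_le (hbd 0).2
    refine hD.preimage_homeomorph (c₁ := (c + b)⁻¹) (c₂ := (c - b)⁻¹)
      (K := ((c - b) ^ 2)⁻¹ * (|χ₀| * 2)) hT2 hT1 hsymm (inv_pos.2 hcb)
      (Eventually.of_forall fun p => ⟨inv_anti₀ (hc0 p) (hbd p).2,
        inv_anti₀ (sub_pos.2 hbc) (hbd p).1⟩) ?_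
    filter_upwards [hK, self_mem_nhdsWithin] with p hp hp0
    refine ⟨(hsm p hp0).inv (hc0 p).ne', ?_⟩
    have d := (hasDerivAt_inv (hc0 p).ne').comp_hasFDerivAt p
      ((hsm p hp0).differentiableAt (by norm_num)).hasFDerivAt
    have e : fderiv ℝ (fun p => (cosFactor c χ p)⁻¹) p
        = -(cosFactor c χ p ^ 2)⁻¹ • fderiv ℝ (cosFactor c χ) p := d.fderiv
    rw [e, norm_smul, norm_neg, norm_inv, norm_pow, Real.norm_of_nonneg (hc0 p).le, mul_assoc]
    have h1 := sub_pos.2 hbc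
    have h2 := (hbd p).1
    gcongr

/-! ### The second-order obstruction -/

/-- Points of a `C^2` submanifold of the plane that approach the origin tangentially to the
horizontal axis satisfy `y / x² → b` with `b` determined by the submanifold. -/
theorem IsCkOneSubmanifoldAt.exists_quadratic_coeff {D : Set Plane}
    (h : IsCkOneSubmanifoldAt 2 D 0) :
    -- The coefficients come before the filter: approaches from the left and from the right must
    -- satisfy one and the same equation.
    ∃ β κ : ℝ, ∀ (l : Filter ℝ) [l.NeBot] (P : ℝ → Plane) (b : ℝ),
      Tendsto (fun t => P t 0) l (𝓝[≠] 0) → Tendsto (fun t => P t 1 / P t 0 ^ 2) l (𝓝 b) →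
      (∀ᶠ t in l, P t ∈ D) → β ≠ 0 ∧ κ + β * b = 0 := by
  obtain ⟨g, hg, hg', hgD⟩ := h.exists_contDiffAt two_ne_zero
  set ℓ := fderiv ℝ g 0 with hℓ
  set e₁ : Plane := EuclideanSpace.single 0 1
  set e₂ : Plane := EuclideanSpace.single 1 1
  -- Strictness bounds the error between `(x, y)` and `(x, 0)` by `o(y)`; plain differentiability
  -- would give only `o(x)`, too coarse at order `x²`.
  have hgs : HasStrictFDerivAt g ℓ 0 :=
    hg.hasStrictFDerivAt' (hg.differentiableAt (by norm_num)).hasFDerivAt (by norm_num)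
  set f : ℝ → ℝ := fun x => g (x • e₁) with hf
  have hline : HasDerivAt (fun x : ℝ => x • e₁) e₁ 0 := by
    simpa using (hasDerivAt_id (0 : ℝ)).smul_const e₁
  have hfd : HasDerivAt f (ℓ e₁) 0 := by
    refine HasFDerivAt.comp_hasDerivAt (f := fun x : ℝ => x • e₁) 0 ?_ hline
    rw [zero_smul]; exact hgs.hasFDerivAt
  have hf2 : ContDiffAt ℝ 2 f 0 := by
    refine ContDiffAt.comp (f := fun x : ℝ => x • e₁) 0 ?_
      (contDiff_id.smul contDiff_const).contDiffAt
    rw [zero_smul]; exact hg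
  obtain ⟨ε, hε, hball⟩ := Metric.eventually_nhds_iff_ball.1 (hf2.eventually (by norm_num))
  set s := Metric.ball (0 : ℝ) ε
  have hs0 : (0 : ℝ) ∈ s := Metric.mem_ball_self hε
  have hsn : s ∈ 𝓝 (0 : ℝ) := Metric.ball_mem_nhds 0 hε
  have htay := taylor_isLittleO (n := 2) (convex_ball (0 : ℝ) ε) hs0
    (fun x hx => (hball x hx).contDiffWithinAt)
  rw [nhdsWithin_eq_nhds.2 hsn] at htay
  set a₂ : ℝ := iteratedDerivWithin 2 f s 0 / 2 with ha₂
  refine ⟨ℓ e₂, a₂, fun l _ P b hX hY hP => ?_⟩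
  have hX0 : Tendsto (fun t => P t 0) l (𝓝 0) := hX.mono_right nhdsWithin_le_nhds
  have hXne : ∀ᶠ t in l, P t 0 ≠ 0 := hX.eventually self_mem_nhdsWithin
  have hYO : (fun t => P t 1) =O[l] fun t => P t 0 ^ 2 :=
    Asymptotics.isBigO_of_div_tendsto_nhds (hXne.mono fun t ht h0 => absurd h0 (pow_ne_zero 2 ht))
      b hY
  have hXX : (fun t => P t 0 ^ 2) =o[l] fun t => P t 0 := by
    have := (Asymptotics.isLittleO_one_iff ℝ).2 hX0
    simpa [sq] using this.mul_isBigO (Asymptotics.isBigO_refl (fun t => P t 0) l)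
  have hYo := hYO.trans_isLittleO hXX
  have hY0 : Tendsto (fun t => P t 1) l (𝓝 0) := hYo.isBigO.trans_tendsto hX0
  have hPe : ∀ t, P t = P t 0 • e₁ + P t 1 • e₂ := fun t => Plane.eq_single_add_single (P t)
  have hXe : Tendsto (fun t => P t 0 • e₁) l (𝓝 0) := by simpa using hX0.smul_const e₁
  have hPt : Tendsto P l (𝓝 0) := by
    have := hXe.add (hY0.smul_const e₂)
    rw [zero_smul, add_zero] at this
    exact this.congr fun t => (hPe t).symm
  have hgP : ∀ᶠ t in l, g (P t) = 0 := by
    filter_upwards [hPt.eventually hgD, hP] with t h1 h2 using h1.1 h2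
  have hg0 : g 0 = 0 :=
    tendsto_nhds_unique (hg.continuousAt.tendsto.comp hPt)
      ((tendsto_const_nhds (x := (0 : ℝ))).congr' (hgP.mono fun t ht => ht.symm))
  -- increment in the vertical direction
  have hi : (fun t => f (P t 0) + P t 1 * ℓ e₂) =o[l] fun t => P t 1 := by
    have := hgs.isLittleO.comp_tendsto (hPt.prodMk_nhds hXe)
    have h2 : (fun t => P t - P t 0 • e₁) = fun t => P t 1 • e₂ := by
      ext t : 1
      conv_lhs => rw [hPe t]
      simp [e₁, e₂]
    have h3 : (fun t => P t 1 • e₂) =O[l] fun t => P t 1 := by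
      refine Asymptotics.IsBigO.of_bound 1 (Eventually.of_forall fun t => ?_)
      simp [norm_smul, e₂]
    have h4 := this.trans_isBigO (k := fun t => P t 1) (by
      change (fun t => P t - P t 0 • e₁) =O[l] _
      rw [h2]; exact h3)
    refine h4.neg_left.congr' ?_ EventuallyEq.rfl
    filter_upwards [hgP] with t ht
    have h5 : P t - P t 0 • e₁ = P t 1 • e₂ := congrFun h2 t
    simp only [Function.comp, ht, h5, map_smul, smul_eq_mul, hf]
    ring
  -- the horizontal direction is tangent
  have hle₁ : ℓ e₁ = 0 := by
    have h1 : (fun t => f (P t 0) - P t 0 * ℓ e₁) =o[l] fun t => P t 0 := by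
      have := (hasDerivAt_iff_isLittleO.1 hfd).comp_tendsto hX0
      simpa [Function.comp_def, hf, hg0] using this
    have h2 : (fun t => P t 0 * ℓ e₁) =o[l] fun t => P t 0 := by
      have h3 : (fun t => P t 1 * ℓ e₂) =o[l] fun t => P t 0 := by
        simpa [mul_comm] using hYo.const_mul_left (ℓ e₂)
      refine (((hi.trans hYo).sub h1).sub h3).congr_left fun t => ?_
      ring
    have h4 := h2.tendsto_div_nhds_zero
    refine tendsto_nhds_unique (tendsto_const_nhds.congr' ?_) h4
    filter_upwards [hXne] with t ht
    field_simp
  have hβ : ℓ e₂ ≠ 0 := by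
    intro h0
    refine hg' (ContinuousLinearMap.ext fun v => ?_)
    rw [Plane.clm_apply]
    change v 0 * ℓ e₁ + v 1 * ℓ e₂ = 0
    rw [hle₁, h0]; ring
  refine ⟨hβ, ?_⟩
  have hT : ∀ x, taylorWithinEval f 2 s 0 x = a₂ * x ^ 2 := by
    intro x
    have hf0 : f 0 = 0 := by simp [hf, hg0]
    have hd : derivWithin f s 0 = 0 := by
      rw [derivWithin_of_mem_nhds hsn, hfd.deriv, hle₁]
    simp only [taylor_within_apply, Finset.sum_range_succ, Finset.sum_range_zero,
      iteratedDerivWithin_zero, iteratedDerivWithin_one, hf0, hd, smul_eq_mul, ha₂]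
    norm_num [Nat.factorial]
    ring
  have hii : (fun t => f (P t 0) - a₂ * P t 0 ^ 2) =o[l] fun t => P t 0 ^ 2 := by
    have := htay.comp_tendsto hX0
    simp only [Function.comp_def, sub_zero] at this
    exact this.congr_left fun t => congrArg (fun z => f (P t 0) - z) (hT (P t 0))
  -- The unknown `f(x)` drops out of the difference, leaving `a₂ x² + y ℓ(e₂) = o(x²)`.
  have h1 := ((hi.trans_isBigO hYO).sub hii).tendsto_div_nhds_zero
  have h2 : Tendsto (fun t => a₂ + ℓ e₂ * (P t 1 / P t 0 ^ 2)) l (𝓝 (a₂ + ℓ e₂ * b)) :=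
    (hY.const_mul _).const_add _
  refine tendsto_nhds_unique h2 (h1.congr' ?_)
  filter_upwards [hXne] with t ht
  field_simp
  ring

/-- The image of a curve `y = a x² + o(x²)` under `p ↦ (c + χ(p) cos θ) p` is not of class `C^2`
at the origin, as its curvature jumps. -/
theorem not_isCkOneSubmanifoldAt_image {c a χ₀ : ℝ} {χ : Plane → ℝ} {T : Plane ≃ₜ Plane}
    {u : ℝ → ℝ} {D : Set Plane} (hT : ∀ p, T p = cosFactor c χ p • p)
    (hχ₀ : ∀ᶠ p in 𝓝 0, χ p = χ₀) (hχpos : 0 < χ₀) (hc : χ₀ < c) (ha : a ≠ 0)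
    (hu : Tendsto (fun t => u t / t ^ 2) (𝓝[≠] 0) (𝓝 a))
    (huD : ∀ᶠ t in 𝓝[≠] 0, !₂[t, u t] ∈ D) {k : ℕ∞} (hk : 2 ≤ k) :
    ¬ IsCkOneSubmanifoldAt k (T '' D) 0 := by
  intro h
  obtain ⟨β, κ, H⟩ := (h.mono hk).exists_quadratic_coeff
  have hid : Tendsto (fun t : ℝ => t) (𝓝[≠] 0) (𝓝 0) := tendsto_id.mono_left nhdsWithin_le_nhds
  have hut : Tendsto (fun t => u t / t) (𝓝[≠] 0) (𝓝 0) := by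
    have := hu.mul hid
    rw [mul_zero] at this
    refine this.congr' ?_
    filter_upwards [self_mem_nhdsWithin] with t ht
    have ht : t ≠ 0 := ht
    field_simp
  have hu0 : Tendsto u (𝓝[≠] 0) (𝓝 0) := by
    have := hut.mul hid
    rw [mul_zero] at this
    refine this.congr' ?_
    filter_upwards [self_mem_nhdsWithin] with t ht
    exact div_mul_cancel₀ _ ht
  have hP0 : Tendsto (fun t => (!₂[t, u t] : Plane)) (𝓝[≠] 0) (𝓝 0) := by
    have h1 := (hid.smul_const (EuclideanSpace.single 0 1 : Plane)).add
      (hu0.smul_const (EuclideanSpace.single 1 1 : Plane))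
    simp only [zero_smul, add_zero] at h1
    refine h1.congr fun t => ?_
    rw [Plane.eq_single_add_single !₂[t, u t]]
    simp
  -- one-sided limits of the direction
  have hnorm : ∀ t, ‖(!₂[t, u t] : Plane)‖ = √(t ^ 2 + u t ^ 2) := fun t => by
    simp [EuclideanSpace.norm_eq, Fin.sum_univ_two]
  have hroot : Tendsto (fun t => √(1 + (u t / t) ^ 2)) (𝓝[≠] 0) (𝓝 1) := by
    have := (((hut.pow 2).const_add 1).sqrt)
    simpa using this
  -- Here `σ` is the sign of `t`. Since `u t / t → 0`, the cosine tends to `σ`, and scaling both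
  -- coordinates by a factor `F` divides `y/x²` by `F`.
  have key : ∀ (σ : ℝ) (l : Filter ℝ) [l.NeBot], |σ| = 1 → l ≤ 𝓝[≠] 0 →
      (∀ᶠ t in l, t = σ * |t|) → β ≠ 0 ∧ κ + β * (a / (c + χ₀ * σ)) = 0 := by
    intro σ l _ hσ hl hlσ
    have hcσ : c + χ₀ * σ ≠ 0 := by
      have : |χ₀ * σ| < c := by rwa [abs_mul, hσ, mul_one, abs_of_pos hχpos]
      have := (abs_lt.1 this).1
      linarith
    have hne : ∀ᶠ t in l, t ≠ 0 := hl self_mem_nhdsWithin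
    have hF : Tendsto (fun t => cosFactor c χ !₂[t, u t]) l (𝓝 (c + χ₀ * σ)) := by
      have h1 : Tendsto (fun t => c + χ₀ * (σ / √(1 + (u t / t) ^ 2))) l
          (𝓝 (c + χ₀ * (σ / 1))) :=
        ((tendsto_const_nhds.div (hroot.mono_left hl) one_ne_zero).const_mul χ₀).const_add c
      rw [div_one] at h1
      refine h1.congr' ?_
      filter_upwards [hlσ, hne, (hP0.mono_left hl).eventually hχ₀] with t ht ht0 hχt
      have hs : √(t ^ 2 + u t ^ 2) = |t| * √(1 + (u t / t) ^ 2) := by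
        rw [← Real.sqrt_sq_eq_abs, ← Real.sqrt_mul (sq_nonneg t)]
        congr 1
        field_simp
      rw [cosFactor, hχt, hnorm, hs]
      congr 2
      have : (!₂[t, u t] : Plane) 0 = t := rfl
      rw [this, ← mul_div_mul_left σ _ (abs_ne_zero.2 ht0), mul_comm |t| σ, ← ht]
    have hFne : ∀ᶠ t in l, cosFactor c χ !₂[t, u t] ≠ 0 := hF.eventually_ne hcσ
    have c0 : ∀ t, T !₂[t, u t] 0 = cosFactor c χ !₂[t, u t] * t := fun t => by simp [hT]
    have c1 : ∀ t, T !₂[t, u t] 1 = cosFactor c χ !₂[t, u t] * u t := fun t => by simp [hT]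
    refine H l (fun t => T !₂[t, u t]) _ ?_ ?_ ?_
    · simp only [c0]
      refine tendsto_nhdsWithin_iff.2 ⟨?_, ?_⟩
      · simpa using hF.mul (hid.mono_left hl)
      · filter_upwards [hne, hFne] with t h1 h2 using mul_ne_zero h2 h1
    · simp only [c0, c1]
      refine ((hu.mono_left hl).div hF hcσ).congr' ?_
      filter_upwards [hne, hFne] with t h1 h2
      simp only [Pi.div_apply]
      field_simp
    · filter_upwards [hl huD] with t ht using mem_image_of_mem T ht
  obtain ⟨hβ, h1⟩ := key 1 (𝓝[>] 0) (by simp)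
    (nhdsWithin_mono _ fun t ht => ne_of_gt ht) (by
      filter_upwards [self_mem_nhdsWithin] with t ht
      rw [abs_of_pos ht, one_mul])
  obtain ⟨-, h2⟩ := key (-1) (𝓝[<] 0) (by simp)
    (nhdsWithin_mono _ fun t ht => ne_of_lt ht) (by
      filter_upwards [self_mem_nhdsWithin] with t ht
      rw [abs_of_neg ht]; ring)
  have h3 : a / (c + χ₀ * 1) = a / (c + χ₀ * -1) := mul_left_cancel₀ hβ (by linarith)
  have p1 : c + χ₀ * 1 ≠ 0 := by linarith
  have p2 : c + χ₀ * -1 ≠ 0 := by linarith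
  rw [div_eq_div_iff p1 p2] at h3
  have := mul_left_cancel₀ ha h3
  linarith

/-! ### Tangent circles as compact test curves -/

/-- The circle `x² + y² = 2ρy` in the plane. -/
def tangentCircle (ρ : ℝ) : Set Plane := Metric.sphere !₂[0, ρ] ρ

theorem mem_tangentCircle {ρ : ℝ} (hρ : 0 ≤ ρ) (p : Plane) :
    p ∈ tangentCircle ρ ↔ p 0 ^ 2 + p 1 ^ 2 - 2 * ρ * p 1 = 0 := by
  rw [tangentCircle, mem_sphere_iff_norm, EuclideanSpace.norm_eq, Fin.sum_univ_two,
    Real.sqrt_eq_iff_mul_self_eq (by positivity) hρ]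
  simp only [PiLp.sub_apply, Real.norm_eq_abs, sq_abs]
  simp
  constructor <;> intro h <;> linarith

/-- The gradient of the defining quadratic vanishes only at the centre, which is not on the circle.
-/
theorem isCkOneSubmanifoldAt_tangentCircle {k : ℕ∞} (hk : k ≠ 0) {ρ : ℝ} (hρ : 0 < ρ) {q : Plane}
    (hq : q ∈ tangentCircle ρ) : IsCkOneSubmanifoldAt k (tangentCircle ρ) q := by
  let π₀ : Plane →L[ℝ] ℝ := EuclideanSpace.proj 0
  let π₁ : Plane →L[ℝ] ℝ := EuclideanSpace.proj 1
  have hd : HasFDerivAt (fun p : Plane => p 0 * p 0 + p 1 * p 1 - 2 * ρ * p 1)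
      (q 0 • π₀ + q 0 • π₀ + (q 1 • π₁ + q 1 • π₁) - (2 * ρ) • π₁) q :=
    ((π₀.hasFDerivAt.mul π₀.hasFDerivAt).add (π₁.hasFDerivAt.mul π₁.hasFDerivAt)).sub
      (π₁.hasFDerivAt.const_mul (2 * ρ))
  have hs : ContDiff ℝ k (fun p : Plane => p 0 * p 0 + p 1 * p 1 - 2 * ρ * p 1) :=
    ((π₀.contDiff.mul π₀.contDiff).add (π₁.contDiff.mul π₁.contDiff)).sub
      (contDiff_const.mul π₁.contDiff)
  refine IsCkOneSubmanifoldAt.of_contDiffOn hk isOpen_univ (mem_univ q) hs.contDiffOn ?_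
    fun p _ => by rw [mem_tangentCircle hρ.le, sq, sq]
  rw [hd.fderiv]
  intro h0
  have h1 := DFunLike.congr_fun h0 (EuclideanSpace.single 0 1)
  have h2 := DFunLike.congr_fun h0 (EuclideanSpace.single 1 1)
  simp [π₀, π₁] at h1 h2
  rw [mem_tangentCircle hρ.le] at hq
  have h3 : q 0 = 0 := by linarith
  have h4 : q 1 = ρ := by linarith
  rw [h3, h4] at hq
  nlinarith [mul_pos hρ hρ]

theorem tangentCircle_subset {ρ r : ℝ} (hr : 2 * ρ ≤ r) (hρ : 0 ≤ ρ) :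
    tangentCircle ρ ⊆ Metric.closedBall 0 r := by
  intro p hp
  have h1 : ‖p - !₂[0, ρ]‖ = ρ := mem_sphere_iff_norm.1 hp
  have h2 : ‖(!₂[0, ρ] : Plane)‖ = ρ := by
    simp [EuclideanSpace.norm_eq, Fin.sum_univ_two, Real.sqrt_sq hρ]
  rw [mem_closedBall_zero_iff]
  calc ‖p‖ = ‖(p - !₂[0, ρ]) + !₂[0, ρ]‖ := by rw [sub_add_cancel]
    _ ≤ ‖p - !₂[0, ρ]‖ + ‖(!₂[0, ρ] : Plane)‖ := norm_add_le _ _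
    _ ≤ r := by linarith

theorem isConnected_tangentCircle {ρ : ℝ} (hρ : 0 ≤ ρ) : IsConnected (tangentCircle ρ) :=
  isConnected_sphere (by
    rw [← Module.finrank_eq_rank]
    simp) _ hρ

theorem isCompact_tangentCircle (ρ : ℝ) : IsCompact (tangentCircle ρ) := isCompact_sphere _ _

/-- A homeomorphism as in `exists_homeomorph_cosFactor` does not map small circles tangent to the
horizontal axis at the origin to `C^2` submanifolds. -/
theorem not_isCkOneSubmanifoldAt_image_tangentCircle {c χ₀ ρ : ℝ} {χ : Plane → ℝ}
    {T : Plane ≃ₜ Plane} (hT : ∀ p, T p = cosFactor c χ p • p)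
    (hχ₀ : ∀ᶠ p in 𝓝 0, χ p = χ₀) (hχpos : 0 < χ₀) (hc : χ₀ < c) (hρ : 0 < ρ)
    {k : ℕ∞} (hk : 2 ≤ k) : ¬ IsCkOneSubmanifoldAt k (T '' tangentCircle ρ) 0 := by
  -- the lower arc of the circle is the graph of `t² / (ρ + √(ρ² - t²))`
  refine not_isCkOneSubmanifoldAt_image (a := 1 / (ρ + ρ))
    (u := fun t => t ^ 2 / (ρ + √(ρ ^ 2 - t ^ 2))) hT hχ₀ hχpos hc (by positivity) ?_ ?_ hk
  · have hcont : Continuous fun t : ℝ => 1 / (ρ + √(ρ ^ 2 - t ^ 2)) :=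
      continuous_const.div (by fun_prop) fun t => by positivity
    have := (hcont.tendsto 0).mono_left (nhdsWithin_le_nhds (s := {0}ᶜ))
    simp only [ne_eq, OfNat.ofNat_ne_zero, not_false_eq_true, zero_pow, sub_zero,
      Real.sqrt_sq hρ.le] at this
    refine this.congr' ?_
    filter_upwards [self_mem_nhdsWithin] with t ht
    have ht : t ≠ 0 := ht
    have : ρ + √(ρ ^ 2 - t ^ 2) ≠ 0 := by positivity
    field_simp
  · have : ∀ᶠ t in 𝓝 (0 : ℝ), 0 < ρ ^ 2 - t ^ 2 := by
      have hcont : Continuous fun t : ℝ => ρ ^ 2 - t ^ 2 := by fun_prop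
      exact hcont.continuousAt.eventually (lt_mem_nhds (by simpa using pow_pos hρ 2))
    filter_upwards [this.filter_mono nhdsWithin_le_nhds] with t ht
    rw [mem_tangentCircle hρ.le]
    have hs := Real.sq_sqrt ht.le
    set s := √(ρ ^ 2 - t ^ 2)
    have hs0 : ρ + s ≠ 0 := by positivity
    have ht2 : t ^ 2 = ρ ^ 2 - s ^ 2 := by linarith
    change t ^ 2 + (t ^ 2 / (ρ + s)) ^ 2 - 2 * ρ * (t ^ 2 / (ρ + s)) = 0
    rw [ht2]
    field_simp
    ring

/-! ### Transport of plane maps to a surface -/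

section Gluing

variable {S : Type*} [TopologicalSpace S]

open Classical in
/-- A map of the plane transported to `S` by a chart and extended by the identity. -/
noncomputable def glueMap (ψ : OpenPartialHomeomorph S Plane) (F : Plane → Plane) (x : S) : S :=
  if x ∈ ψ.source then ψ.symm (F (ψ x)) else x

theorem glueMap_of_mem {ψ : OpenPartialHomeomorph S Plane} {F : Plane → Plane} {x : S}
    (hx : x ∈ ψ.source) : glueMap ψ F x = ψ.symm (F (ψ x)) := if_pos hx

theorem glueMap_of_notMem {ψ : OpenPartialHomeomorph S Plane} {F : Plane → Plane} {x : S}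
    (hx : x ∉ ψ.source) : glueMap ψ F x = x := if_neg hx

/-- The support is the image of a compact set, hence closed in a Hausdorff surface; a point outside
the chart domain has a neighbourhood that misses it. -/
theorem glueMap_eventually_eq_self [T2Space S] {ψ : OpenPartialHomeomorph S Plane}
    {F : Plane → Plane} {K : Set Plane} (hK : IsCompact K) (hKψ : K ⊆ ψ.target)
    (hF : ∀ p ∉ K, F p = p) {x : S} (hx : x ∉ ψ.source) : ∀ᶠ y in 𝓝 x, glueMap ψ F y = y := by
  have hcl : IsClosed (ψ.symm '' K) :=
    (hK.image_of_continuousOn (ψ.continuousOn_symm.mono hKψ)).isClosed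
  have hxK : x ∉ ψ.symm '' K := by
    rintro ⟨p, hp, rfl⟩
    exact hx (ψ.map_target (hKψ hp))
  filter_upwards [hcl.isOpen_compl.mem_nhds hxK] with y hy
  by_cases hys : y ∈ ψ.source
  · rw [glueMap_of_mem hys, hF _ fun h => hy ⟨_, h, ψ.left_inv hys⟩, ψ.left_inv hys]
  · exact glueMap_of_notMem hys

theorem continuous_glueMap [T2Space S] {ψ : OpenPartialHomeomorph S Plane}
    {F : Plane → Plane} {K : Set Plane} (hK : IsCompact K) (hKψ : K ⊆ ψ.target)
    (hF : ∀ p ∉ K, F p = p) (hFc : Continuous F) (hFψ : MapsTo F ψ.target ψ.target) :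
    Continuous (glueMap ψ F) := by
  rw [continuous_iff_continuousAt]
  intro x
  by_cases hx : x ∈ ψ.source
  · have h1 : ContinuousOn (fun y => ψ.symm (F (ψ y))) ψ.source :=
      ψ.continuousOn_symm.comp (hFc.comp_continuousOn ψ.continuousOn)
        fun y hy => hFψ (ψ.map_source hy)
    refine (h1.continuousAt (ψ.open_source.mem_nhds hx)).congr ?_
    filter_upwards [ψ.open_source.mem_nhds hx] with y hy
    exact (glueMap_of_mem hy).symm
  · exact continuousAt_id.congr
      ((glueMap_eventually_eq_self hK hKψ hF hx).mono fun y hy => hy.symm)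

theorem leftInverse_glueMap {ψ : OpenPartialHomeomorph S Plane} {F G : Plane → Plane}
    (hFψ : MapsTo F ψ.target ψ.target) (hFG : Function.LeftInverse G F) :
    Function.LeftInverse (glueMap ψ G) (glueMap ψ F) := by
  intro x
  by_cases hx : x ∈ ψ.source
  · have h1 := hFψ (ψ.map_source hx)
    rw [glueMap_of_mem hx, glueMap_of_mem (ψ.map_target h1), ψ.right_inv h1, hFG, ψ.left_inv hx]
  · rw [glueMap_of_notMem hx, glueMap_of_notMem hx]

/-- A value outside `U` would be a fixed point, and injectivity would make it equal to the point of
`U` it came from. -/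
theorem mapsTo_of_eq_self {X : Type*} {F : X → X} {K U : Set X} (hKU : K ⊆ U)
    (hinj : Function.Injective F) (hF : ∀ p ∉ K, F p = p) :
    MapsTo F U U := by
  intro p hp
  by_contra h
  have h1 : F (F p) = F p := hF _ fun hK => h (hKU hK)
  exact h (by rwa [hinj h1])

/-- Inside the chart domain the claim is the planar one read through `ψ`; elsewhere the glued map is
locally the identity. -/
theorem IsCkOneSubmanifoldAt.preimage_glueMap [T2Space S] [ChartedSpace Plane S]
    [IsManifold (𝓡 2) 1 S] {ψ : OpenPartialHomeomorph S Plane}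
    (hψ : ψ ∈ IsManifold.maximalAtlas (𝓡 2) ((1 : ℕ∞) : WithTop ℕ∞) S)
    {T : Plane ≃ₜ Plane} {K : Set Plane} (hK : IsCompact K) (hKψ : K ⊆ ψ.target)
    (hT : ∀ p ∉ K, T p = p)
    (hTs : ∀ D q, IsCkOneSubmanifoldAt 1 D (T q) → IsCkOneSubmanifoldAt 1 (T ⁻¹' D) q)
    {C : Set S} {x : S} (hC : IsCkOneSubmanifoldAt 1 C (glueMap ψ T x)) :
    IsCkOneSubmanifoldAt 1 (glueMap ψ T ⁻¹' C) x := by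
  have : IsManifold (𝓡 2) ((1 : ℕ∞) : WithTop ℕ∞) S := by simpa
  by_cases hx : x ∈ ψ.source
  · have hm : MapsTo T ψ.target ψ.target := mapsTo_of_eq_self hKψ T.injective hT
    have hTx := hm (ψ.map_source hx)
    rw [glueMap_of_mem hx] at hC
    have h1 := hC.preimage_chart hψ (ψ.map_target hTx)
    rw [ψ.right_inv hTx] at h1
    refine IsCkOneSubmanifoldAt.of_preimage_chart hψ hx ((hTs _ _ h1).congr ?_)
    filter_upwards [ψ.open_target.mem_nhds (ψ.map_source hx)] with p hp
    simp only [mem_preimage]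
    rw [glueMap_of_mem (ψ.map_target hp), ψ.right_inv hp]
  · rw [glueMap_of_notMem hx] at hC
    refine hC.congr ?_
    filter_upwards [glueMap_eventually_eq_self hK hKψ hT hx] with y hy
    rw [mem_preimage, hy]

end Gluing

/-! ### From the local condition to the groups -/

section Preserving

variable {S : Type*} [TopologicalSpace S] [ChartedSpace Plane S] {k : ℕ∞}

theorem IsCkCurve.preimage_homeomorph {f : S ≃ₜ S}
    (hf : ∀ C x, IsCkOneSubmanifoldAt k C (f x) → IsCkOneSubmanifoldAt k (f ⁻¹' C) x)
    {C : Set S} (hC : IsCkCurve k C) : IsCkCurve k (f ⁻¹' C) :=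
  ⟨hC.1.preimage f.continuous, f.isConnected_preimage.2 hC.2.1, fun p hp => hf C p (hC.2.2 _ hp)⟩

theorem IsCkCurve.image_homeomorph {f : S ≃ₜ S}
    (hf : ∀ C x, IsCkOneSubmanifoldAt k C (f.symm x) → IsCkOneSubmanifoldAt k (f.symm ⁻¹' C) x)
    {C : Set S} (hC : IsCkCurve k C) : IsCkCurve k (f '' C) := by
  rw [f.image_eq_preimage_symm]
  exact hC.preimage_homeomorph hf

/-- Closedness, connectedness and compactness are topological, so the local condition on `f` and its
inverse serves both groups. -/
theorem mem_properHomeoCk_and_mem_homeoCk {f : S ≃ₜ S}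
    (hf : ∀ C x, IsCkOneSubmanifoldAt k C (f x) → IsCkOneSubmanifoldAt k (f ⁻¹' C) x)
    (hf' : ∀ C x, IsCkOneSubmanifoldAt k C (f.symm x) →
      IsCkOneSubmanifoldAt k (f.symm ⁻¹' C) x) :
    f ∈ ProperHomeoCk k S ∧ f ∈ HomeoCk k S := by
  refine ⟨⟨fun C hC => hC.image_homeomorph hf', fun C hC => ?_⟩,
    ⟨fun C hC => ⟨hC.1.image f.continuous, hC.2.image_homeomorph hf'⟩,
      fun C hC => ⟨hC.1.image f.symm.continuous, ?_⟩⟩⟩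
  · exact hC.image_homeomorph (f := f.symm) hf
  · exact hC.2.image_homeomorph (f := f.symm) hf

theorem isSimpleClosedCkCurve_image_tangentCircle [T2Space S] [IsManifold (𝓡 2) k S] (hk : k ≠ 0)
    {ψ : OpenPartialHomeomorph S Plane}
    (hψ : ψ ∈ IsManifold.maximalAtlas (𝓡 2) (k : WithTop ℕ∞) S) {ρ : ℝ} (hρ : 0 < ρ)
    (hρψ : tangentCircle ρ ⊆ ψ.target) :
    IsSimpleClosedCkCurve k (ψ.symm '' tangentCircle ρ) := by
  have hcont := ψ.continuousOn_symm.mono hρψ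
  have hcomp := (isCompact_tangentCircle ρ).image_of_continuousOn hcont
  refine ⟨hcomp, hcomp.isClosed, (isConnected_tangentCircle hρ.le).image _ hcont, ?_⟩
  rintro _ ⟨q, hq, rfl⟩
  have hqt := hρψ hq
  refine IsCkOneSubmanifoldAt.of_preimage_chart hψ (ψ.map_target hqt) ?_
  rw [ψ.right_inv hqt]
  refine (isCkOneSubmanifoldAt_tangentCircle hk hρ hq).congr ?_
  filter_upwards [ψ.open_target.mem_nhds hqt] with p hp
  refine ⟨fun h => mem_image_of_mem _ h, ?_⟩
  rintro ⟨p', hp', h⟩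
  rwa [← ψ.symm.injOn (hρψ hp') hp h]

end Preserving

/-! ### Failure of the inclusion on every surface -/

theorem zero_mem_tangentCircle {ρ : ℝ} (hρ : 0 ≤ ρ) : (0 : Plane) ∈ tangentCircle ρ := by
  rw [mem_tangentCircle hρ]; simp

/-- For every `r > 0` there is a homeomorphism as in `exists_homeomorph_cosFactor` that is
supported in the ball of radius `r`. -/
theorem exists_homeomorph_cosFactor_of_support {r : ℝ} (hr : 0 < r) :
    ∃ (χ : Plane → ℝ) (χ₀ : ℝ) (T : Plane ≃ₜ Plane), 0 < χ₀ ∧ χ₀ < 1 ∧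
      (∀ᶠ p in 𝓝 0, χ p = χ₀) ∧ (∀ p, T p = cosFactor 1 χ p • p) ∧
      (∀ p ∉ Metric.closedBall 0 r, T p = p) ∧
      (∀ D q, IsCkOneSubmanifoldAt 1 D (T q) → IsCkOneSubmanifoldAt 1 (T ⁻¹' D) q) ∧
      ∀ D q, IsCkOneSubmanifoldAt 1 D (T.symm q) → IsCkOneSubmanifoldAt 1 (T.symm ⁻¹' D) q := by
  let B : ContDiffBump (0 : Plane) := ⟨r / 2, r, by positivity, by linarith⟩
  have hB : ContDiff ℝ 1 B := B.contDiff
  have hcont : Continuous fun p : Plane => fderiv ℝ B p p :=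
    (hB.continuous_fderiv (by norm_num)).clm_apply continuous_id
  have hsupp : HasCompactSupport fun p : Plane => fderiv ℝ B p p :=
    (B.hasCompactSupport.fderiv ℝ).mono fun p hp h0 => hp (by
      change fderiv ℝ B p p = 0
      rw [h0, zero_apply])
  obtain ⟨M, hM⟩ := hsupp.exists_bound_of_continuous hcont
  have hM0 : 0 ≤ M := (norm_nonneg _).trans (hM 0)
  -- With `χ = ε B`, this makes `|χ + dχ(p)| ≤ ε (1 + M) = 1/2`, below the constant `c = 1` that
  -- makes the map the identity where `χ = 0`.
  set ε : ℝ := 1 / (2 * (1 + M)) with hε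
  have hε0 : 0 < ε := by positivity
  have hεM : ε * (1 + M) = 1 / 2 := by rw [hε]; field_simp
  have hε1 : ε < 1 := by nlinarith
  have hloc : ∀ᶠ p in 𝓝 (0 : Plane), ε * B p = ε := by
    filter_upwards [B.eventuallyEq_one] with p hp
    rw [hp]; simp
  obtain ⟨T, hT, h1, h2⟩ := exists_homeomorph_cosFactor (c := 1) (b := ε) (χ₀ := ε)
    (χ := fun p => ε * B p) (contDiff_const.mul hB) hloc hε1 (fun p => by
      rw [abs_of_nonneg (mul_nonneg hε0.le B.nonneg)]
      exact mul_le_of_le_one_right hε0.le B.le_one) (fun p => by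
      rw [fderiv_const_mul (hB.differentiable (by norm_num) p), smul_apply, smul_eq_mul,
        ← mul_add, abs_mul, abs_of_pos hε0]
      have h3 : |B p + fderiv ℝ B p p| ≤ 1 + M :=
        (abs_add_le _ _).trans (add_le_add
          (by rw [abs_of_nonneg B.nonneg]; exact B.le_one) (hM p))
      have := mul_le_mul_of_nonneg_left h3 hε0.le
      linarith)
  refine ⟨_, ε, T, hε0, hε1, hloc, hT, fun p hp => ?_, h1, h2⟩
  have : B p = 0 := B.zero_of_le_dist (by
    rw [Metric.mem_closedBall, not_le] at hp
    exact hp.le)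
  rw [hT, cosFactor, this]; simp

/-- A `C^k` chart of a surface around a given point, centred at the origin. -/
theorem exists_centred_chart {S : Type*} [TopologicalSpace S] [ChartedSpace Plane S] {k : ℕ∞}
    [IsManifold (𝓡 2) k S] (x : S) :
    ∃ ψ ∈ IsManifold.maximalAtlas (𝓡 2) (k : WithTop ℕ∞) S, x ∈ ψ.source ∧ ψ x = 0 := by
  let τ : Plane ≃ₜ Plane := Homeomorph.addRight (-(chartAt Plane x x))
  have hτ : τ.toOpenPartialHomeomorph ∈
      IsManifold.maximalAtlas (𝓡 2) (k : WithTop ℕ∞) Plane := by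
    rw [IsManifold.mem_maximalAtlas_iff_contMDiffOn]
    simp only [contMDiffOn_iff_contDiffOn]
    exact ⟨(contDiff_id.add contDiff_const).contDiffOn, (contDiff_id.add contDiff_const).contDiffOn⟩
  refine ⟨(chartAt Plane x).trans τ.toOpenPartialHomeomorph,
    IsCkOneSubmanifoldAt.trans_mem_maximalAtlas (IsManifold.chart_mem_maximalAtlas x) hτ, ?_, ?_⟩
  · simp
  · simp [τ]

/-- The obstruction is local, so one chart suffices: a map supported in a ball of the chart
preserves all `C^1` curves, yet spoils a small circle through the centre. That circle is compact, so
it refutes both inclusions. -/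
theorem not_homeoCk_le {S : Type*} [TopologicalSpace S] [T2Space S] [Nonempty S]
    [ChartedSpace Plane S] [IsManifold (𝓡 2) ∞ S] {k : ℕ∞} (hk : 2 ≤ k) :
    ¬ HomeoCk 1 S ≤ HomeoCk k S ∧ ¬ ProperHomeoCk 1 S ≤ ProperHomeoCk k S := by
  have hmf : ∀ j : ℕ∞, IsManifold (𝓡 2) j S := fun j =>
    IsManifold.of_le (n := ∞) (by exact_mod_cast le_top)
  have := hmf k
  have hm1 : IsManifold (𝓡 2) 1 S := by exact_mod_cast hmf 1
  have hk1 : k ≠ 0 := fun h => by simp [h] at hk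
  obtain ⟨ψ, hψ, hx, hx0⟩ := exists_centred_chart (k := k) (Classical.arbitrary S)
  set x := Classical.arbitrary S
  have hψ1 : ψ ∈ IsManifold.maximalAtlas (𝓡 2) ((1 : ℕ∞) : WithTop ℕ∞) S :=
    IsManifold.maximalAtlas_subset_of_le
      (by exact_mod_cast (one_le_two (α := ℕ∞)).trans hk) hψ
  have h0t : (0 : Plane) ∈ ψ.target := hx0 ▸ ψ.map_source hx
  obtain ⟨r, hr, hrψ⟩ := Metric.nhds_basis_closedBall.mem_iff.1 (ψ.open_target.mem_nhds h0t)
  have hρ : 0 < r / 2 := by positivity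
  have hcirc : tangentCircle (r / 2) ⊆ ψ.target :=
    (tangentCircle_subset (by linarith) hρ.le).trans hrψ
  obtain ⟨χ, χ₀, T, hχpos, hχ1, hloc, hT, hTid, hT1, hT2⟩ :=
    exists_homeomorph_cosFactor_of_support hr
  have hK := isCompact_closedBall (0 : Plane) r
  have hTid' : ∀ p ∉ Metric.closedBall 0 r, T.symm p = p := fun p hp => by
    rw [T.symm_apply_eq, hTid p hp]
  have hm : MapsTo T ψ.target ψ.target := mapsTo_of_eq_self hrψ T.injective hTid
  have hm' : MapsTo T.symm ψ.target ψ.target := mapsTo_of_eq_self hrψ T.symm.injective hTid'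
  let f : S ≃ₜ S :=
    { toFun := glueMap ψ T
      invFun := glueMap ψ T.symm
      left_inv := leftInverse_glueMap hm T.symm_apply_apply
      right_inv := leftInverse_glueMap hm' T.apply_symm_apply
      continuous_toFun := continuous_glueMap hK hrψ hTid T.continuous hm
      continuous_invFun := continuous_glueMap hK hrψ hTid' T.symm.continuous hm' }
  obtain ⟨hfP, hfH⟩ := mem_properHomeoCk_and_mem_homeoCk (k := 1) (f := f)
    (fun C x hC => IsCkOneSubmanifoldAt.preimage_glueMap hψ1 hK hrψ hTid hT1 hC)
    (fun C x hC => IsCkOneSubmanifoldAt.preimage_glueMap hψ1 hK hrψ hTid' hT2 hC)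
  have hC := isSimpleClosedCkCurve_image_tangentCircle hk1 hψ hρ hcirc
  have hfψ : ∀ q ∈ ψ.target, f (ψ.symm q) = ψ.symm (T q) := fun q hq => by
    change glueMap ψ T (ψ.symm q) = _
    rw [glueMap_of_mem (ψ.map_target hq), ψ.right_inv hq]
  have hnot : ¬ IsCkCurve k (f '' (ψ.symm '' tangentCircle (r / 2))) := by
    intro h
    have hmem : ψ.symm 0 ∈ f '' (ψ.symm '' tangentCircle (r / 2)) := by
      refine ⟨_, mem_image_of_mem _ (zero_mem_tangentCircle hρ.le), ?_⟩
      rw [hfψ 0 h0t, hT, smul_zero]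
    have h1 := IsCkOneSubmanifoldAt.preimage_chart (h.2.2 _ hmem) hψ (ψ.map_target h0t)
    rw [ψ.right_inv h0t] at h1
    refine not_isCkOneSubmanifoldAt_image_tangentCircle hT hloc hχpos hχ1 hρ hk (h1.congr ?_)
    filter_upwards [ψ.open_target.mem_nhds h0t] with p hp
    constructor
    · rintro ⟨_, ⟨q, hq, rfl⟩, h2⟩
      rw [hfψ q (hcirc hq)] at h2
      exact ⟨q, hq, ψ.symm.injOn (hm (hcirc hq)) hp h2⟩
    · rintro ⟨q, hq, rfl⟩
      exact ⟨_, mem_image_of_mem _ hq, hfψ q (hcirc hq)⟩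
  exact ⟨fun hle => hnot ((hle hfH).1 _ hC).2, fun hle => hnot ((hle hfP).1 _ hC.2)⟩

/-! ### The parabola and the curvature of its image -/

theorem isCkCurve_parabola : IsCkCurve ⊤ parabola := by
  let π₀ : Plane →L[ℝ] ℝ := EuclideanSpace.proj 0
  let π₁ : Plane →L[ℝ] ℝ := EuclideanSpace.proj 1
  refine ⟨isClosed_eq π₁.continuous (π₀.continuous.pow 2), ?_, fun q hq => ?_⟩
  · have : parabola = range fun t : ℝ => (!₂[t, t ^ 2] : Plane) := by
      ext p
      constructor
      · intro hp
        refine ⟨p 0, ?_⟩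
        ext i; fin_cases i
        · rfl
        · exact Eq.symm hp
      · rintro ⟨t, rfl⟩
        rfl
    rw [this]
    exact isConnected_range (by fun_prop)
  · have hd : HasFDerivAt (fun p : Plane => p 1 - p 0 * p 0)
        (π₁ - (q 0 • π₀ + q 0 • π₀)) q :=
      π₁.hasFDerivAt.sub (π₀.hasFDerivAt.mul π₀.hasFDerivAt)
    have hs : ContDiff ℝ (⊤ : ℕ∞) (fun p : Plane => p 1 - p 0 * p 0) :=
      π₁.contDiff.sub (π₀.contDiff.mul π₀.contDiff)
    refine IsCkOneSubmanifoldAt.of_contDiffOn (by simp) isOpen_univ (mem_univ q) hs.contDiffOn ?_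
      fun p _ => by rw [sub_eq_zero, ← sq]; rfl
    rw [hd.fderiv]
    intro h0
    have := DFunLike.congr_fun h0 (EuclideanSpace.single 1 1)
    simp [π₀, π₁] at this

theorem mFactor_eq_cosFactor (p : Plane) : mFactor p = cosFactor 2 (fun _ => 1) p := by
  rw [mFactor, cosFactor, EuclideanSpace.norm_eq, Fin.sum_univ_two]
  simp only [Real.norm_eq_abs, sq_abs]
  split_ifs with h
  -- At the origin `0 / 0 = 0`, which gives the prescribed value `2`.
  · simp [h]
  · ring

theorem mMap_eq_smul (p : Plane) : mMap p = cosFactor 2 (fun _ => 1) p • p := by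
  rw [mMap, mFactor_eq_cosFactor]
  ext i; fin_cases i <;> simp [mul_comm]

/-- The parametrized parabola, scaled by a variable factor. -/
noncomputable def scaledParabola (m : ℝ → ℝ) (t : ℝ) : Plane := m t • !₂[t, t ^ 2]

theorem hasDerivAt_mk_two {x y : ℝ → ℝ} {x' y' t : ℝ} (hx : HasDerivAt x x' t)
    (hy : HasDerivAt y y' t) : HasDerivAt (fun t => (!₂[x t, y t] : Plane)) !₂[x', y'] t := by
  have h := (hx.smul_const (EuclideanSpace.single 0 1 : Plane)).add
    (hy.smul_const (EuclideanSpace.single 1 1 : Plane))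
  have e : ∀ a b : ℝ, (!₂[a, b] : Plane) =
      a • EuclideanSpace.single 0 1 + b • EuclideanSpace.single 1 1 := fun a b =>
    Plane.eq_single_add_single !₂[a, b]
  simp only [e]
  exact h

theorem hasDerivAt_parabola (t : ℝ) :
    HasDerivAt (fun t : ℝ => (!₂[t, t ^ 2] : Plane)) !₂[1, 2 * t] t := by
  refine hasDerivAt_mk_two (hasDerivAt_id t) ?_
  simpa using hasDerivAt_pow 2 t

theorem hasDerivAt_scaledParabola {m : ℝ → ℝ} (hm : Differentiable ℝ m) (t : ℝ) :
    HasDerivAt (scaledParabola m) (m t • !₂[1, 2 * t] + deriv m t • !₂[t, t ^ 2]) t :=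
  (hm t).hasDerivAt.smul (hasDerivAt_parabola t)

theorem contDiff_scaledParabola {m : ℝ → ℝ} {n : WithTop ℕ∞} (hm : ContDiff ℝ n m) :
    ContDiff ℝ n (scaledParabola m) := by
  refine hm.smul ((contDiff_piLp 2).2 fun i => ?_)
  fin_cases i
  · exact contDiff_id
  · exact contDiff_id.pow 2

/-- Second coordinate of the velocity minus `t` times the first is `t m(t)`: the terms in `m'`
cancel. -/
theorem deriv_scaledParabola_ne_zero {m : ℝ → ℝ} (hm : Differentiable ℝ m) {t : ℝ}
    (ht : t ≠ 0) (hmt : m t ≠ 0) : deriv (scaledParabola m) t ≠ 0 := by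
  rw [(hasDerivAt_scaledParabola hm t).deriv]
  intro h0
  have h1 := congrArg (fun v : Plane => v 0) h0
  have h2 := congrArg (fun v : Plane => v 1) h0
  simp at h1 h2
  have : m t * t = 0 := by linear_combination h2 - t * h1
  exact (mul_ne_zero hmt ht) this

/-- At `0` the velocity is `(m, 0)` and the acceleration `(2m', 2m)`, so `m'` drops out and the
curvature is `2m²/m³`; continuity does the rest. -/
theorem tendsto_signedCurvature_scaledParabola {m : ℝ → ℝ} (hm : ContDiff ℝ 2 m)
    (hm0 : 0 < m 0) : Tendsto (signedCurvature (scaledParabola m)) (𝓝 0) (𝓝 (2 / m 0)) := by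
  have hmd : Differentiable ℝ m := hm.differentiable (by norm_num)
  have hmd' : Differentiable ℝ (deriv m) :=
    (hm.iterate_deriv' 1 1).differentiable (by norm_num)
  have hc := contDiff_scaledParabola hm
  have h1 : ContDiff ℝ 1 (deriv (scaledParabola m)) := hc.iterate_deriv' 1 1
  have hc1 := h1.continuous
  have hc2 : Continuous (deriv (deriv (scaledParabola m))) := h1.continuous_deriv le_rfl
  have hder : deriv (scaledParabola m) =
      fun t => m t • !₂[1, 2 * t] + deriv m t • !₂[t, t ^ 2] := by
    ext t : 1
    exact (hasDerivAt_scaledParabola hmd t).deriv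
  have e1 : deriv (scaledParabola m) 0 = !₂[m 0, 0] := by
    rw [hder]
    ext i; fin_cases i <;> simp
  have d0 : HasDerivAt (fun t : ℝ => (!₂[1, 2 * t] : Plane)) !₂[0, 2] 0 := by
    refine hasDerivAt_mk_two (hasDerivAt_const 0 1) ?_
    simpa using (hasDerivAt_id (0 : ℝ)).const_mul 2
  have e2 : deriv (deriv (scaledParabola m)) 0 = !₂[2 * deriv m 0, 2 * m 0] := by
    have := (((hmd 0).hasDerivAt.smul d0).add ((hmd' 0).hasDerivAt.smul (hasDerivAt_parabola 0)))
    rw [hder]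
    refine this.deriv.trans ?_
    ext i; fin_cases i
    · simp; ring
    · simp; ring
  have hn : ‖(!₂[m 0, 0] : Plane)‖ = m 0 := by
    simp [EuclideanSpace.norm_eq, Fin.sum_univ_two, Real.sqrt_sq hm0.le]
  have hv : signedCurvature (scaledParabola m) 0 = 2 / m 0 := by
    rw [signedCurvature, e1, e2, hn]
    simp
    field_simp
  rw [← hv]
  have hco : ∀ (i : Fin 2) {g : ℝ → Plane}, Continuous g → Continuous fun t => g t i :=
    fun i g hg => (EuclideanSpace.proj i : Plane →L[ℝ] ℝ).continuous.comp hg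
  refine ContinuousAt.div ?_ ?_ ?_
  · exact (((hco 0 hc1).mul (hco 1 hc2)).sub ((hco 1 hc1).mul (hco 0 hc2))).continuousAt
  · exact (hc1.norm.pow 3).continuousAt
  · rw [e1, hn]; positivity

/-- The factor by which `M` scales the half `σ t > 0` of the parabola. -/
noncomputable def halfFactor (σ t : ℝ) : ℝ := 2 + σ / √(1 + t ^ 2)

theorem contDiff_halfFactor (σ : ℝ) {n : WithTop ℕ∞} : ContDiff ℝ n (halfFactor σ) := by
  refine contDiff_const.add (contDiff_const.div ?_ fun t => by positivity)
  exact (contDiff_const.add (contDiff_id.pow 2)).sqrt fun t => by simp only [id]; positivity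

/-- With `σ` the sign of `t`, the cosine at `(t, t²)` is `σ/√(1 + t²)`. Each half of the image thus
lies on a curve smooth across `0`, so one-sided limits of curvature reduce to continuity. -/
theorem imageParam_eq {σ t : ℝ} (ht : t ≠ 0) (hσ : t = σ * |t|) :
    imageParam t = scaledParabola (halfFactor σ) t := by
  rw [imageParam, mMap_eq_smul, scaledParabola, cosFactor, halfFactor]
  have hn : ‖(!₂[t, t ^ 2] : Plane)‖ = |t| * √(1 + t ^ 2) := by
    rw [EuclideanSpace.norm_eq, Fin.sum_univ_two, ← Real.sqrt_sq_eq_abs,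
      ← Real.sqrt_mul (sq_nonneg t)]
    congr 1
    simp
    ring
  have h0 : (!₂[t, t ^ 2] : Plane) 0 = t := rfl
  rw [hn, h0, one_mul]
  congr 2
  rw [← mul_div_mul_left σ _ (abs_ne_zero.2 ht), mul_comm |t| σ, ← hσ]

theorem eventually_imageParam_eq_of_pos {t : ℝ} (ht : 0 < t) :
    imageParam =ᶠ[𝓝 t] scaledParabola (halfFactor 1) := by
  filter_upwards [lt_mem_nhds ht] with s hs
  exact imageParam_eq hs.ne' (by rw [abs_of_pos hs, one_mul])

theorem eventually_imageParam_eq_of_neg {t : ℝ} (ht : t < 0) :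
    imageParam =ᶠ[𝓝 t] scaledParabola (halfFactor (-1)) := by
  filter_upwards [gt_mem_nhds ht] with s hs
  exact imageParam_eq (ne_of_lt hs) (by rw [abs_of_neg hs]; ring)

theorem signedCurvature_congr {γ δ : ℝ → Plane} {t : ℝ} (h : γ =ᶠ[𝓝 t] δ) :
    signedCurvature γ t = signedCurvature δ t := by
  rw [signedCurvature, signedCurvature, h.deriv.deriv_eq, h.deriv_eq]

theorem halfFactor_pos {σ : ℝ} (hσ : |σ| ≤ 1) (t : ℝ) : 0 < halfFactor σ t := by
  have h1 : 1 ≤ √(1 + t ^ 2) := Real.one_le_sqrt.2 (by nlinarith [sq_nonneg t])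
  have h2 : |σ / √(1 + t ^ 2)| ≤ 1 := by
    rw [abs_div, abs_of_pos (by linarith : 0 < √(1 + t ^ 2))]
    exact div_le_one_of_le₀ (hσ.trans h1) (by linarith)
  have := (abs_le.1 h2).1
  unfold halfFactor
  linarith

theorem imageParam_contDiffAt_and_deriv_ne_zero {t : ℝ} (ht : t ≠ 0) :
    ContDiffAt ℝ ∞ imageParam t ∧ deriv imageParam t ≠ 0 := by
  have key : ∀ σ : ℝ, |σ| ≤ 1 → imageParam =ᶠ[𝓝 t] scaledParabola (halfFactor σ) →
      ContDiffAt ℝ ∞ imageParam t ∧ deriv imageParam t ≠ 0 := by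
    intro σ hσ h
    refine ⟨(contDiff_scaledParabola (contDiff_halfFactor σ)).contDiffAt.congr_of_eventuallyEq h,
      ?_⟩
    rw [h.deriv_eq]
    exact deriv_scaledParabola_ne_zero
      ((contDiff_halfFactor σ (n := 1)).differentiable (by norm_num)) ht (halfFactor_pos hσ t).ne'
  rcases lt_or_gt_of_ne ht with h | h
  · exact key _ (by simp) (eventually_imageParam_eq_of_neg h)
  · exact key _ (by simp) (eventually_imageParam_eq_of_pos h)

theorem tendsto_signedCurvature_imageParam_left :
    Tendsto (signedCurvature imageParam) (𝓝[<] 0) (𝓝 2) := by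
  have h := tendsto_signedCurvature_scaledParabola (contDiff_halfFactor (-1))
    (halfFactor_pos (by simp) 0)
  have e : 2 / halfFactor (-1) 0 = 2 := by norm_num [halfFactor]
  rw [e] at h
  refine (h.mono_left nhdsWithin_le_nhds).congr' ?_
  filter_upwards [self_mem_nhdsWithin] with t ht
  exact (signedCurvature_congr (eventually_imageParam_eq_of_neg ht)).symm

theorem tendsto_signedCurvature_imageParam_right :
    Tendsto (signedCurvature imageParam) (𝓝[>] 0) (𝓝 (2 / 3)) := by
  have h := tendsto_signedCurvature_scaledParabola (contDiff_halfFactor 1)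
    (halfFactor_pos (by simp) 0)
  have e : 2 / halfFactor 1 0 = 2 / 3 := by norm_num [halfFactor]
  rw [e] at h
  refine (h.mono_left nhdsWithin_le_nhds).congr' ?_
  filter_upwards [self_mem_nhdsWithin] with t ht
  exact (signedCurvature_congr (eventually_imageParam_eq_of_pos ht)).symm

/-! ### The main theorem -/

theorem mainTheorem6 :
    -- the map `M` is a homeomorphism of the plane
    (∃ f : Plane ≃ₜ Plane, (∀ p, f p = mMap p) ∧
      -- `M` and its inverse send `C^1` curves to `C^1` curves
      (∀ C : Set Plane, IsCkCurve 1 C → IsCkCurve 1 (f '' C) ∧ IsCkCurve 1 (f.symm '' C)) ∧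
      f ∈ HomeoCk 1 Plane ∧
      -- the image of the parabola is not a `C^k` curve for any `k ≥ 2`
      (∀ k : ℕ∞, 2 ≤ k → ¬ IsCkCurve k (f '' parabola)) ∧
      ∀ k : ℕ∞, 2 ≤ k → f ∉ HomeoCk k Plane) ∧
    -- the parabola is a `C^∞` curve, and the curvature of its image under `M` jumps at the origin
    IsCkCurve ⊤ parabola ∧
    (∀ t : ℝ, t ≠ 0 → ContDiffAt ℝ ∞ imageParam t ∧ deriv imageParam t ≠ 0) ∧
    Tendsto (signedCurvature imageParam) (𝓝[<] 0) (𝓝 2) ∧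
    Tendsto (signedCurvature imageParam) (𝓝[>] 0) (𝓝 (2 / 3)) ∧
    -- on no smooth surface is `Homeo^1` contained in `Homeo^k` with `k ≥ 2`
    (∀ (S : Type*) [TopologicalSpace S] [T2Space S] [Nonempty S]
      [ChartedSpace Plane S] [IsManifold (𝓡 2) ∞ S] (k : ℕ∞), 2 ≤ k →
        ¬ HomeoCk 1 S ≤ HomeoCk k S ∧ ¬ ProperHomeoCk 1 S ≤ ProperHomeoCk k S) := by
  refine ⟨?_, isCkCurve_parabola, fun t ht => imageParam_contDiffAt_and_deriv_ne_zero ht,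
    tendsto_signedCurvature_imageParam_left, tendsto_signedCurvature_imageParam_right,
    fun S _ _ _ _ _ k hk => not_homeoCk_le hk⟩
  have hloc : ∀ᶠ p in 𝓝 (0 : Plane), (fun _ : Plane => (1 : ℝ)) p = 1 :=
    Eventually.of_forall fun _ => rfl
  obtain ⟨f, hf, h1, h2⟩ := exists_homeomorph_cosFactor (c := 2) (b := 1) (χ₀ := 1)
    (χ := fun _ => 1) contDiff_const hloc (by norm_num) (fun p => by simp) (fun p => by simp)
  obtain ⟨hP, hH⟩ := mem_properHomeoCk_and_mem_homeoCk h1 h2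
  have hf0 : f 0 = 0 := by rw [hf, smul_zero]
  refine ⟨f, fun p => by rw [hf, mMap_eq_smul], fun C hC => ⟨hP.1 C hC, hP.2 C hC⟩, hH, ?_, ?_⟩
  · intro k hk h
    have hmem : (0 : Plane) ∈ f '' parabola := ⟨0, by simp [parabola], hf0⟩
    refine not_isCkOneSubmanifoldAt_image (a := 1) (u := fun t => t ^ 2) hf hloc one_pos
      (by norm_num) one_ne_zero ?_ (Eventually.of_forall fun t => rfl) hk (h.2.2 _ hmem)
    refine tendsto_const_nhds.congr' ?_
    filter_upwards [self_mem_nhdsWithin] with t ht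
    exact (div_self (pow_ne_zero 2 ht)).symm
  -- Membership in `HomeoCk` tests compact curves only, so the unit circle tangent to the axis
  -- replaces the parabola.
  · intro k hk h
    have hC := isSimpleClosedCkCurve_image_tangentCircle (S := Plane) (k := k)
      (ψ := OpenPartialHomeomorph.refl Plane) (fun h => by simp [h] at hk)
      (StructureGroupoid.id_mem_maximalAtlas _) (one_pos (α := ℝ)) (subset_univ _)
    have hid : (OpenPartialHomeomorph.refl Plane).symm '' tangentCircle 1 = tangentCircle 1 :=
      image_id _
    rw [hid] at hC
    have hmem : (0 : Plane) ∈ f '' tangentCircle 1 := ⟨0, zero_mem_tangentCircle zero_le_one, hf0⟩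
    exact not_isCkOneSubmanifoldAt_image_tangentCircle hf hloc one_pos (by norm_num) one_pos hk
      ((h.1 _ hC).2.2.2 _ hmem)
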